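/- Let $d\ge 0$ be an integer, $E=\mathbb R^d$, and let $\mathbf P(X)$ be the set of Borel probability measures on $X$ and $\mathbf P_{sym}(E^N)$ the set of $G\in\mathbf P(E^N)$ that are invariant under permutations of the $N$ coordinates. For $F,G\in\mathbf P(E^j)$ let $$W_1(F,G)=\inf_{\pi\in\Pi(F,G)}\int_{E^j\times E^j}\frac1j\sum_{i=1}^j\bigl(|x_i-y_i|\wedge1\bigr)\,\pi(dX,dY),$$ where $\Pi(F,G)$ is the set of probability measures on $E^j\times E^j$ with first marginal $F$ and second marginal $G$. Let $\mathcal W_{W_1}$ be the Monge--Kantorovich--Wasserstein distance on $\mathbf P(\mathbf P(E))$ associated with the distance $W_1$ on $\mathbf P(E)$, that is, $\mathcal W_{W_1}(P,Q)=\inf_{\pi\in\Pi(P,Q)}\int W_1(\rho,\eta)\,\pi(d\rho,d\eta)$. For $G^N\in\mathbf P(E^N)$, $N\ge1$, let $G^N_j\in\mathbf P(E^j)$ $(1\le j\le N)$ be the law of the first $j$ coordinates under $G^N$, and let $\hat G^N\in\mathbf P(\mathbf P(E))$ be the law of the empirical measure $\mu^N_{\mathcal Z}=\frac1N\sum_{i=1}^N\delta_{\mathcal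 Z_i}$, where $\mathcal Z=(\mathcal Z_1,\dots,\mathcal Z_N)$ has law $G^N$. For $f\in\mathbf P(E)$ put $$\Omega_j(G^N;f)=W_1(G^N_j,f^{\otimes j})\quad(2\le j\le N),\qquad \Omega_\infty(G^N;f)=\mathcal W_{W_1}(\hat G^N,\delta_f),$$ and $M_k(f)=\int_E|v|^k f(dv)$. **Theorem.** (i) $\Omega_\infty(G^N;f)=\mathbb E\bigl[W_1(\mu^N_{\mathcal Z},f)\bigr]$ for all $f\in\mathbf P(E)$, $N\ge1$ and $G^N\in\mathbf P_{sym}(E^N)$. (ii) Let $f\in\mathbf P(E)$ and let $G^N\in\mathbf P_{sym}(E^N)$ for every $N$. The following are equivalent: * $\Omega_j(G^N;f)\to0$ as $N\to\infty$ for some fixed $j\ge2$; * $\Omega_j(G^N;f)\to0$ as $N\to\infty$ for every fixed $j\ge2$; * $\Omega_\infty(G^N;f)\to0$ as $N\to\infty$; * $\Omega_N(G^N;f)=W_1(G^N,f^{\otimes N})\to0$ as $N\to\infty$. (iii) For all real $M>1$ and $k>1$ there exist $\alpha_1,\alpha_2,C>0$, depending only on $d$, $M$ and $k$, such that for all $f\in\mathbf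 P(E)$, all $N\ge1$ and all $G^N\in\mathbf P_{sym}(E^N)$ with $M_k(G^N_1)\le M$ and $M_k(f)\le M$, $$\Omega_j(G^N;f)\le C\Bigl(\Omega_\ell(G^N;f)^{\alpha_1}+\frac1{N^{\alpha_2}}\Bigr)\qquad\text{for all } j,\ell\in\{2,\dots,N\}\cup\{\infty\}.$$ -/

import Mathlib

open MeasureTheory Filter Topology
open scoped ENNReal

noncomputable section

/-- Optimal transport cost between `μ` and `ν` for the cost function `c`: the infimum of `∫ c dπ`
over all measures `π` on `X × X` with first marginal `μ` and second marginal `ν`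
(all costs are non-negative, so they take values in `[0, ∞]`). -/
def transportCost {X : Type*} [MeasurableSpace X] (c : X → X → ℝ≥0∞) (μ ν : Measure X) : ℝ≥0∞ :=
  ⨅ π ∈ {π : Measure (X × X) | π.fst = μ ∧ π.snd = ν}, ∫⁻ p, c p.1 p.2 ∂π

section Chaos

variable {E : Type*} [MeasurableSpace E]

/-- The truncated distance `|x - y| ∧ 1` on `E`. -/
def truncDist [PseudoEMetricSpace E] (x y : E) : ℝ≥0∞ := min (edist x y) 1

/-- The Monge-Kantorovich-Wasserstein distance `W₁` on `𝐏(E)`, for the distance `|x - y| ∧ 1`. -/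
def W1 [PseudoEMetricSpace E] (μ ν : ProbabilityMeasure E) : ℝ≥0∞ :=
  transportCost truncDist (μ : Measure E) (ν : Measure E)

/-- The renormalized Monge-Kantorovich-Wasserstein distance `W₁` on `𝐏(Eʲ)`, for the distance
`(1 / j) ∑ᵢ (|xᵢ - yᵢ| ∧ 1)` on `Eʲ`. -/
def W1Pow [PseudoEMetricSpace E] {j : ℕ} (F G : ProbabilityMeasure (Fin j → E)) : ℝ≥0∞ :=
  transportCost (fun x y : Fin j → E => (j : ℝ≥0∞)⁻¹ * ∑ i, truncDist (x i) (y i))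
    (F : Measure (Fin j → E)) (G : Measure (Fin j → E))

/-- The Monge-Kantorovich-Wasserstein distance on `𝐏(𝐏(E))` associated with the distance `W₁`
on `𝐏(E)`. -/
def WW1 [PseudoEMetricSpace E] (P Q : ProbabilityMeasure (ProbabilityMeasure E)) : ℝ≥0∞ :=
  transportCost W1 (P : Measure (ProbabilityMeasure E)) (Q : Measure (ProbabilityMeasure E))

/-- Invariance of a probability measure on `Eᴺ` under all permutations of the coordinates,
i.e. `G ∈ 𝐏_sym(Eᴺ)`. -/
def IsSymmetricMeasure {N : ℕ} (G : ProbabilityMeasure (Fin N → E)) : Prop :=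
  ∀ σ : Equiv.Perm (Fin N),
    (G : Measure (Fin N → E)).map (fun x i => x (σ i)) = (G : Measure (Fin N → E))

/-- The `j`-th marginal `G_j ∈ 𝐏(Eʲ)` of `G ∈ 𝐏(Eᴺ)`: the law of the first `j` coordinates. -/
def marginal {j N : ℕ} (h : j ≤ N) (G : ProbabilityMeasure (Fin N → E)) :
    ProbabilityMeasure (Fin j → E) :=
  G.map (f := fun x i => x (Fin.castLE h i))
    (measurable_pi_lambda _ fun _ => measurable_pi_apply _).aemeasurable

/-- The law on `E` of the first coordinate under `G ∈ 𝐏(Eᴺ)`, i.e. the first marginal `G₁`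
under the identification `E¹ = E`. -/
def firstMarginal {N : ℕ} (hN : 1 ≤ N) (G : ProbabilityMeasure (Fin N → E)) :
    ProbabilityMeasure E :=
  G.map (f := fun x => x ⟨0, hN⟩) (measurable_pi_apply _).aemeasurable

/-- The tensor power `f^{⊗ j} ∈ 𝐏(Eʲ)`. -/
def tensorPow (f : ProbabilityMeasure E) (j : ℕ) : ProbabilityMeasure (Fin j → E) :=
  ProbabilityMeasure.pi fun _ => f

/-- The moment `M_k(f) = ∫ |v|ᵏ f(dv)`. -/
def moment [NormedAddCommGroup E] (k : ℝ) (f : ProbabilityMeasure E) : ℝ≥0∞ :=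
  ∫⁻ v, ENNReal.ofReal (‖v‖ ^ k) ∂(f : Measure E)

/-- The empirical measure `μ^N_x = (1 / N) ∑ᵢ δ_{xᵢ} ∈ 𝐏(E)` of a configuration `x ∈ Eᴺ`,
`N ≥ 1`. -/
def empiricalMeasure {N : ℕ} (hN : 1 ≤ N) (x : Fin N → E) : ProbabilityMeasure E :=
  ⟨(N : ℝ≥0∞)⁻¹ • ∑ i, Measure.dirac (x i), ⟨by
    have h0 : (N : ℝ≥0∞) ≠ 0 := by exact_mod_cast (by omega : N ≠ 0)
    simp [ENNReal.inv_mul_cancel h0 (ENNReal.natCast_ne_top N)]⟩⟩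

theorem measurable_empiricalMeasure {N : ℕ} (hN : 1 ≤ N) :
    Measurable (empiricalMeasure (E := E) hN) := by
  refine Measurable.subtype_mk ?_
  refine Measure.measurable_of_measurable_coe _ fun s hs => ?_
  simp only [Measure.smul_apply, Measure.finsetSum_apply, smul_eq_mul]
  refine Measurable.const_mul (Finset.measurable_sum _ fun i _ => ?_) _
  exact (Measure.measurable_coe hs).comp (Measure.measurable_dirac.comp (measurable_pi_apply i))

/-- `Ĝᴺ ∈ 𝐏(𝐏(E))`: the law of the empirical measure of a random configuration with law `G`. -/
def empiricalLaw {N : ℕ} (hN : 1 ≤ N) (G : ProbabilityMeasure (Fin N → E)) :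
    ProbabilityMeasure (ProbabilityMeasure E) :=
  G.map (measurable_empiricalMeasure hN).aemeasurable

/-- The Dirac mass `δ_f ∈ 𝐏(𝐏(E))`. -/
def diracLaw (f : ProbabilityMeasure E) : ProbabilityMeasure (ProbabilityMeasure E) :=
  ⟨Measure.dirac f, inferInstance⟩

/-- `Ω_j(G; f) = W₁(G_j, f^{⊗ j})` for `G ∈ 𝐏(Eᴺ)` and `j ≤ N`. -/
def OmegaFin [PseudoEMetricSpace E] {j N : ℕ} (h : j ≤ N) (G : ProbabilityMeasure (Fin N → E))
    (f : ProbabilityMeasure E) : ℝ≥0∞ :=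
  W1Pow (marginal h G) (tensorPow f j)

/-- `Ω_∞(G; f) = 𝓦_{W₁}(Ĝ, δ_f)` for `G ∈ 𝐏(Eᴺ)`, `N ≥ 1`. -/
def OmegaInf [PseudoEMetricSpace E] {N : ℕ} (hN : 1 ≤ N) (G : ProbabilityMeasure (Fin N → E))
    (f : ProbabilityMeasure E) : ℝ≥0∞ :=
  WW1 (empiricalLaw hN G) (diracLaw f)

/-- `Ω_j(G; f)` for an index `j ∈ {2, …, N} ∪ {∞}`. -/
def Omega [PseudoEMetricSpace E] {N : ℕ} (hN : 1 ≤ N) (G : ProbabilityMeasure (Fin N → E))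
    (f : ProbabilityMeasure E) : WithTop (Set.Icc 2 N) → ℝ≥0∞
  | none => OmegaInf hN G f
  | some j => OmegaFin j.2.2 G f

end Chaos

end

/-! Everything is driven by the law of a pair of coordinates, through a variance estimate. Let `φ`
be a Lipschitz observable with values in `[0, 1]`. In the mean square of its empirical average,
centred at `∫ φ df`, the diagonal terms contribute at most `1 / N`. By symmetry all off-diagonal
terms equal one pair correlation, which vanishes under `f ⊗ f` and is therefore at most a multiple
of the Lipschitz constant times `Ω₂` (`integral_sq_average_le`, `ofReal_abs_integral_mul_le`). A
Lipschitz partition of unity subordinate to `m` balls of radius of order `ε` reduces `W1 μ f` to `m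
+ 1` such averages, up to `O(ε)` and twice the `f`-mass outside the balls. Hence
`OmegaInf_le_of_covering`, which bounds `Ω_∞` by `Ω₂`.

In the other direction, `Ω_j ≤ Ω_N`, because a coupling of symmetric laws can be averaged over
cyclic shifts of the indices (`W1Pow_marginal_le`). Moreover the distance between two symmetric laws
on `Eᴺ` is at most the mean `W1` distance between the empirical measures of independent
configurations: by Birkhoff's theorem some permutation matches the points at no more than that cost,
and averaging over relabellings turns the matching into a coupling
(`W1Pow_le_lintegral_W1_empiricalMeasure`). The triangle inequality through `f` gives `Ω_N(G) ≤
Ω_∞(G) + Ω_∞(f^{⊗N})`, and the last term falls under the variance estimate with `Ω₂ = 0`.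

For the equivalences, tightness of `f` fixes the balls before `N → ∞`. For the rates, nets of
polynomial size and Markov's inequality make every error a power of `ε`, which is then chosen as a
power of `1 / N + Ω₂`. The formula for `Ω_∞` holds because a Dirac mass admits only the product
coupling; the work there lies in the measurability of `W1` (`measurable_W1`). -/

open ProbabilityTheory

noncomputable section

/-! ### Couplings, gluing and elementary transport bounds. -/

section Transport

variable {X Y Z X' Y' : Type*} [MeasurableSpace X] [MeasurableSpace Y] [MeasurableSpace Z]
  [MeasurableSpace X'] [MeasurableSpace Y']

theorem transportCost_le {c : X → X → ℝ≥0∞} {μ ν : Measure X} {π : Measure (X × X)}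
    (h1 : π.fst = μ) (h2 : π.snd = ν) : transportCost c μ ν ≤ ∫⁻ p, c p.1 p.2 ∂π :=
  iInf₂_le π ⟨h1, h2⟩

theorem le_transportCost {c : X → X → ℝ≥0∞} {μ ν : Measure X} {a : ℝ≥0∞}
    (h : ∀ π : Measure (X × X), π.fst = μ → π.snd = ν → a ≤ ∫⁻ p, c p.1 p.2 ∂π) :
    a ≤ transportCost c μ ν :=
  le_iInf₂ fun π hπ => h π hπ.1 hπ.2

/-- The law of a pair of random variables is a coupling of their laws. -/
theorem transportCost_map_le {c : X → X → ℝ≥0∞} (P : Measure Y)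
    {f g : Y → X} (hf : Measurable f) (hg : Measurable g) :
    transportCost c (P.map f) (P.map g) ≤ ∫⁻ y, c (f y) (g y) ∂P := by
  refine (transportCost_le (π := P.map fun y => (f y, g y)) ?_ ?_).trans
    (lintegral_map_le _ _)
  · rw [Measure.fst_map_prodMk hg]
  · rw [Measure.snd_map_prodMk hf]

/-- A coupling of `f_* μ` with another measure lifts to a coupling of `μ`. -/
theorem exists_lift_fst [StandardBorelSpace Y] [Nonempty Y] (μ : Measure X) [IsFiniteMeasure μ]
    {f : X → X'} (hf : Measurable f) (π : Measure (X' × Y)) (h : π.fst = μ.map f) :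
    ∃ π' : Measure (X × Y), π'.fst = μ ∧ π'.map (Prod.map f id) = π := by
  have : IsFiniteMeasure π := ⟨by
    rw [← Measure.fst_univ, h]; exact measure_lt_top _ _⟩
  -- Disintegrate `π` over its first marginal and, given `x`, draw the second variable from the
  -- conditional law at `f x`.
  refine ⟨μ ⊗ₘ (π.condKernel.comap f hf), Measure.fst_compProd _ _, ?_⟩
  conv_rhs => rw [← π.disintegrate π.condKernel, h]
  ext s hs
  rw [Measure.map_apply (by fun_prop) hs, Measure.compProd_apply (hs.preimage (by fun_prop)),
    Measure.compProd_apply hs, lintegral_map (Kernel.measurable_kernel_prodMk_left hs) hf]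
  rfl

theorem exists_lift_snd [StandardBorelSpace X] [Nonempty X] (ν : Measure Y) [IsFiniteMeasure ν]
    {g : Y → Y'} (hg : Measurable g) (π : Measure (X × Y')) (h : π.snd = ν.map g) :
    ∃ π' : Measure (X × Y), π'.snd = ν ∧ π'.map (Prod.map id g) = π := by
  obtain ⟨π', h1, h2⟩ := exists_lift_fst ν hg (π.map Prod.swap) (by
    rw [Measure.fst_map_swap, h])
  refine ⟨π'.map Prod.swap, by rw [Measure.snd_map_swap, h1], ?_⟩
  have h3 : π = (π.map Prod.swap).map Prod.swap := by
    rw [Measure.map_map measurable_swap measurable_swap]; simp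
  rw [h3, ← h2, Measure.map_map (by fun_prop) (by fun_prop),
    Measure.map_map (by fun_prop) (by fun_prop)]
  rfl

theorem transportCost_comm {c : X → X → ℝ≥0∞} (hc : ∀ x y, c x y = c y x) (μ ν : Measure X) :
    transportCost c μ ν = transportCost c ν μ := by
  have key : ∀ μ ν : Measure X, transportCost c μ ν ≤ transportCost c ν μ := fun μ ν =>
    le_transportCost fun π h1 h2 => by
      refine (transportCost_le (π := π.map Prod.swap) (by rw [Measure.fst_map_swap, h2])
        (by rw [Measure.snd_map_swap, h1])).trans ?_
      refine (lintegral_map_le _ _).trans (lintegral_mono fun p => ?_)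
      simp [hc p.1]
  exact le_antisymm (key _ _) (key _ _)

/-- Gluing: the second coupling is lifted along the second projection of the first, so that one
measure carries all three variables. -/
theorem transportCost_triangle [StandardBorelSpace X] [Nonempty X] {c : X → X → ℝ≥0∞}
    (hcm : Measurable fun p : X × X => c p.1 p.2)
    (hc : ∀ x y z, c x z ≤ c x y + c y z) (μ ν ρ : Measure X) [IsFiniteMeasure μ] :
    transportCost c μ ρ ≤ transportCost c μ ν + transportCost c ν ρ := by
  rw [transportCost, transportCost, transportCost, ENNReal.iInf_add]
  refine le_iInf fun π₁ => ?_
  rw [ENNReal.iInf_add]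
  refine le_iInf fun h₁ => ?_
  rw [ENNReal.add_iInf]
  refine le_iInf fun π₂ => ?_
  rw [ENNReal.add_iInf]
  refine le_iInf fun h₂ => ?_
  have : IsFiniteMeasure π₁ := ⟨by
    rw [← Measure.fst_univ, h₁.1]; exact measure_lt_top _ _⟩
  obtain ⟨π, h3, h4⟩ := exists_lift_fst π₁ measurable_snd π₂ (by
    rw [h₂.1, ← h₁.2]; rfl)
  have e1 : μ = π.map fun q => q.1.1 := by
    rw [← h₁.1, ← h3, Measure.fst, Measure.fst, Measure.map_map (by fun_prop) (by fun_prop)]; rfl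
  have e2 : ρ = π.map fun q => q.2 := by
    rw [← h₂.2, ← h4, Measure.snd, Measure.map_map (by fun_prop) (by fun_prop)]; rfl
  change transportCost c μ ρ ≤ _
  rw [e1, e2, ← h4, ← h3, Measure.fst, lintegral_map hcm (by fun_prop),
    lintegral_map hcm (by fun_prop), ← lintegral_add_left (by fun_prop)]
  exact (transportCost_map_le π (by fun_prop) (by fun_prop)).trans
    (lintegral_mono fun q => hc _ _ _)

/-- Transport between image measures can be realised upstairs. -/
theorem transportCost_comp_le [StandardBorelSpace X] [Nonempty X] [StandardBorelSpace Y]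
    [Nonempty Y] {c : X → X → ℝ≥0∞} (hcm : Measurable fun p : X × X => c p.1 p.2)
    (μ : Measure Y) [IsFiniteMeasure μ] {f g : Y → X} (hf : Measurable f) (hg : Measurable g) :
    transportCost (fun y y' => c (f y) (g y')) μ μ ≤ transportCost c (μ.map f) (μ.map g) := by
  refine le_transportCost fun π h1 h2 => ?_
  obtain ⟨π₁, h3, h4⟩ := exists_lift_fst μ hf π h1
  obtain ⟨π₂, h5, h6⟩ := exists_lift_snd μ hg π₁ (by
    rw [← h2, ← h4, Measure.snd, Measure.snd, Measure.map_map (by fun_prop) (by fun_prop)]; rfl)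
  refine (transportCost_le (π := π₂) ?_ h5).trans ?_
  · rw [← h3, ← h6, Measure.fst, Measure.fst, Measure.map_map (by fun_prop) (by fun_prop)]; rfl
  · rw [← h4, lintegral_map hcm (by fun_prop), ← h6, lintegral_map (by fun_prop) (by fun_prop)]
    rfl

/-- The transport cost is bounded by the mass of the non-common parts. -/
theorem transportCost_add_le {c : X → X → ℝ≥0∞} (hc0 : ∀ x, c x x = 0) (hc1 : ∀ x y, c x y ≤ 1)
    (κ μ ν : Measure X) [IsFiniteMeasure μ] [IsFiniteMeasure ν]
    (h : μ Set.univ = ν Set.univ) :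
    transportCost c (κ + μ) (κ + ν) ≤ μ Set.univ := by
  rcases eq_or_ne (μ Set.univ) 0 with h0 | h0
  · have hμ : μ = 0 := Measure.measure_univ_eq_zero.1 h0
    have hν : ν = 0 := Measure.measure_univ_eq_zero.1 (h ▸ h0)
    rw [hμ, hν, add_zero]
    have := transportCost_map_le (c := c) κ measurable_id measurable_id
    simpa [hc0] using this
  have ht : μ Set.univ ≠ ∞ := measure_ne_top _ _
  -- The common part stays on the diagonal at no cost; the rest is coupled by the normalised
  -- product, at unit cost at most.
  refine (transportCost_le (π := κ.map (fun x => (x, x)) + (μ Set.univ)⁻¹ • μ.prod ν)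
    ?_ ?_).trans ?_
  · rw [Measure.fst_add, Measure.fst_map_prodMk measurable_id']
    simp only [Measure.map_id', Measure.fst, Measure.map_smul, Measure.map_fst_prod]
    rw [← h, smul_smul, ENNReal.inv_mul_cancel h0 ht, one_smul]
  · rw [Measure.snd_add, Measure.snd_map_prodMk measurable_id']
    simp only [Measure.map_id', Measure.snd, Measure.map_smul, Measure.map_snd_prod]
    rw [smul_smul, ENNReal.inv_mul_cancel h0 ht, one_smul]
  · rw [lintegral_add_measure]
    have h1 : ∫⁻ p, c p.1 p.2 ∂(κ.map fun x => (x, x)) ≤ 0 :=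
      (lintegral_map_le _ _).trans (by simp [hc0])
    have h2 : ∫⁻ p, c p.1 p.2 ∂((μ Set.univ)⁻¹ • μ.prod ν) ≤ μ Set.univ := by
      refine (lintegral_mono (f := fun p : X × X => c p.1 p.2) (g := fun _ => 1)
        fun p => hc1 p.1 p.2).trans ?_
      rw [lintegral_one, Measure.smul_apply, ← Set.univ_prod_univ, Measure.prod_prod, ← h,
        smul_eq_mul, ← mul_assoc, ENNReal.inv_mul_cancel h0 ht, one_mul]
    calc _ ≤ 0 + μ Set.univ := add_le_add h1 h2
      _ = _ := zero_add _

/-- The common part is the sum with weights `min (a i) (b i)`. The truncated differences `a i - b i`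
and `b i - a i` are the two excesses, and they have equal total mass. -/
theorem transportCost_sum_dirac_le {ι : Type*} [Fintype ι] {c : X → X → ℝ≥0∞}
    (hc0 : ∀ x, c x x = 0) (hc1 : ∀ x y, c x y ≤ 1) (z : ι → X) {a b : ι → ℝ≥0∞}
    (ha : ∑ i, a i = 1) (hb : ∑ i, b i = 1) :
    transportCost c (∑ i, a i • Measure.dirac (z i)) (∑ i, b i • Measure.dirac (z i)) ≤
      ∑ i, (a i - b i) := by
  have split : ∀ a b : ι → ℝ≥0∞, ∑ i, a i • Measure.dirac (z i) =
      ∑ i, min (a i) (b i) • Measure.dirac (z i) + ∑ i, (a i - b i) • Measure.dirac (z i) := by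
    intro a b
    rw [← Finset.sum_add_distrib]
    refine Finset.sum_congr rfl fun i _ => ?_
    rw [← add_smul, add_comm, tsub_add_min]
  have mass : ∀ w : ι → ℝ≥0∞, (∑ i, w i • Measure.dirac (z i)) Set.univ = ∑ i, w i := by
    intro w; simp
  have fin : ∀ {a : ι → ℝ≥0∞} (b : ι → ℝ≥0∞), ∑ i, a i = 1 →
      IsFiniteMeasure (∑ i, (a i - b i) • Measure.dirac (z i)) := fun {a} b ha => ⟨by
    rw [mass]
    refine lt_of_le_of_lt (Finset.sum_le_sum fun i _ => tsub_le_self) ?_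
    rw [ha]; exact ENNReal.one_lt_top⟩
  rw [split a b, split b a]
  simp only [min_comm (b _) (a _)]
  have := fin b ha
  have := fin a hb
  refine (transportCost_add_le hc0 hc1 _ _ _ ?_).trans (mass _).le
  rw [mass, mass]
  have e : ∀ a b : ι → ℝ≥0∞, ∑ i, a i = ∑ i, (a i - b i) + ∑ i, min (a i) (b i) := by
    intro a b
    rw [← Finset.sum_add_distrib]
    exact Finset.sum_congr rfl fun i _ => tsub_add_min.symm
  have h1 := e a b
  have h2 := e b a
  simp only [min_comm (b _) (a _)] at h2
  have hm : ∑ i, min (a i) (b i) ≠ ∞ := by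
    refine ne_top_of_le_ne_top ENNReal.one_ne_top ?_
    rw [← ha]; exact Finset.sum_le_sum fun i _ => min_le_left _ _
  exact (ENNReal.add_left_inj hm).1 (by rw [← h1, ← h2, ha, hb])

end Transport

/-! ### The truncated metric. -/

section TruncDist

variable {E : Type*} [PseudoEMetricSpace E]

theorem truncDist_self (x : E) : truncDist x x = 0 := by simp [truncDist]

theorem truncDist_comm (x y : E) : truncDist x y = truncDist y x := by
  simp [truncDist, edist_comm]

theorem truncDist_le_one (x y : E) : truncDist x y ≤ 1 := min_le_right _ _

theorem truncDist_triangle (x y z : E) : truncDist x z ≤ truncDist x y + truncDist y z := by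
  unfold truncDist
  rcases le_total (edist x y) 1 with h1 | h1
  · rcases le_total (edist y z) 1 with h2 | h2
    · rw [min_eq_left h1, min_eq_left h2]
      exact (min_le_left _ _).trans (edist_triangle _ _ _)
    · rw [min_eq_right h2]
      exact (min_le_right _ _).trans le_add_self
  · rw [min_eq_right h1]
    exact (min_le_right _ _).trans le_self_add

variable [MeasurableSpace E] [BorelSpace E] [SecondCountableTopology E]

@[fun_prop]
theorem Measurable.truncDist {α : Type*} [MeasurableSpace α] {f g : α → E} (hf : Measurable f)
    (hg : Measurable g) : Measurable fun a => truncDist (f a) (g a) := by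
  unfold _root_.truncDist
  exact (hf.edist hg).min measurable_const

end TruncDist

theorem nonempty_of_probabilityMeasure {X : Type*} [MeasurableSpace X]
    (μ : ProbabilityMeasure X) : Nonempty X := by
  by_contra h
  rw [not_nonempty_iff] at h
  exact IsProbabilityMeasure.ne_zero (μ : Measure X) (Measure.eq_zero_of_isEmpty _)

theorem map_simpleFunc_eq {E : Type*} [MeasurableSpace E] (μ : Measure E) (T : SimpleFunc E E) :
    μ.map T = ∑ a : T.range, μ (T ⁻¹' {(a : E)}) • Measure.dirac (a : E) := by
  classical
  ext s hs
  rw [Measure.map_apply T.measurable hs]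
  have : T ⁻¹' s = T ⁻¹' (T.range.filter (fun a => a ∈ s) : Finset E) := by
    ext x; simp
  rw [this, ← sum_measure_preimage_singleton _ fun a _ => T.measurableSet_fiber a,
    Finset.sum_filter, Measure.finsetSum_apply, ← Finset.sum_coe_sort T.range]
  refine Finset.sum_congr rfl fun a _ => ?_
  simp [Measure.dirac_apply' _ hs, Set.indicator_apply]

/-! ### The distance `W1` and its measurability. -/

section W1

variable {E : Type*} [PseudoEMetricSpace E] [MeasurableSpace E]

theorem W1_le_one (μ ν : ProbabilityMeasure E) : W1 μ ν ≤ 1 := by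
  refine (transportCost_le (π := (μ : Measure E).prod (ν : Measure E)) (by simp) (by simp)).trans ?_
  refine (lintegral_mono (f := fun p : E × E => truncDist p.1 p.2) (g := fun _ => 1)
    fun p => truncDist_le_one p.1 p.2).trans ?_
  simp

theorem W1_comm (μ ν : ProbabilityMeasure E) : W1 μ ν = W1 ν μ :=
  transportCost_comm truncDist_comm _ _

theorem W1_map_le (μ : ProbabilityMeasure E) {T : E → E} (hT : Measurable T) :
    W1 μ (μ.map hT.aemeasurable) ≤ ∫⁻ x, truncDist x (T x) ∂(μ : Measure E) := by
  have := transportCost_map_le (c := truncDist) (μ : Measure E) measurable_id hT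
  simpa [W1] using this

variable [BorelSpace E] [SecondCountableTopology E] [StandardBorelSpace E]

theorem W1_triangle (μ ν ρ : ProbabilityMeasure E) : W1 μ ρ ≤ W1 μ ν + W1 ν ρ := by
  have := nonempty_of_probabilityMeasure μ
  exact transportCost_triangle (by fun_prop) truncDist_triangle _ _ _

/-- Transport between weighted sums of Dirac masses depends continuously on the weights. -/
theorem continuous_transportCost_sum_dirac {ι : Type*} [Fintype ι] (z : ι → E) :
    Continuous fun w : stdSimplex ℝ ι × stdSimplex ℝ ι =>
      (transportCost truncDist (∑ i, ENNReal.ofReal (w.1 i) • Measure.dirac (z i))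
        (∑ i, ENNReal.ofReal (w.2 i) • Measure.dirac (z i))).toReal := by
  set F := fun w : stdSimplex ℝ ι × stdSimplex ℝ ι =>
      transportCost truncDist (∑ i, ENNReal.ofReal (w.1 i) • Measure.dirac (z i))
        (∑ i, ENNReal.ofReal (w.2 i) • Measure.dirac (z i)) with hF
  have hnn : ∀ (w : stdSimplex ℝ ι) i, 0 ≤ w i := fun w i => w.2.1 i
  have hs : ∀ w : stdSimplex ℝ ι, ∑ i, w i = 1 := fun w => w.2.2
  have hsum : ∀ w : stdSimplex ℝ ι, ∑ i, ENNReal.ofReal (w i) = 1 := fun w => by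
    rw [← ENNReal.ofReal_sum_of_nonneg fun i _ => hnn w i, hs, ENNReal.ofReal_one]
  have htc : ∀ v w : stdSimplex ℝ ι,
      transportCost truncDist (∑ i, ENNReal.ofReal (v i) • Measure.dirac (z i))
        (∑ i, ENNReal.ofReal (w i) • Measure.dirac (z i)) ≤
      ENNReal.ofReal (∑ i, |v i - w i|) := fun v w => by
    refine (transportCost_sum_dirac_le truncDist_self truncDist_le_one z (hsum v)
      (hsum w)).trans ?_
    rw [ENNReal.ofReal_sum_of_nonneg fun i _ => abs_nonneg _]
    refine Finset.sum_le_sum fun i _ => ?_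
    rw [← ENNReal.ofReal_sub _ (hnn w i)]
    exact ENNReal.ofReal_le_ofReal (le_abs_self _)
  -- The cost is 1-Lipschitz in the weights for the `ℓ¹` distance.
  have hle : ∀ v w, F v ≤ F w + ENNReal.ofReal (∑ i, |v.1 i - w.1 i| + ∑ i, |v.2 i - w.2 i|) := by
    intro v w
    have hn : Nonempty E := by
      by_contra h
      rw [not_nonempty_iff] at h
      have : IsEmpty ι := ⟨fun i => h.elim (z i)⟩
      simpa using hsum v.1
    have fin : ∀ w : stdSimplex ℝ ι,
        IsFiniteMeasure (∑ i, ENNReal.ofReal (w i) • Measure.dirac (z i)) := fun w => ⟨by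
      simp [hsum]⟩
    have := fin v.1
    have := fin w.1
    have t1 := transportCost_triangle (c := truncDist (E := E)) (by fun_prop) truncDist_triangle
      (∑ i, ENNReal.ofReal (v.1 i) • Measure.dirac (z i))
      (∑ i, ENNReal.ofReal (w.1 i) • Measure.dirac (z i))
      (∑ i, ENNReal.ofReal (v.2 i) • Measure.dirac (z i))
    have t2 := transportCost_triangle (c := truncDist (E := E)) (by fun_prop) truncDist_triangle
      (∑ i, ENNReal.ofReal (w.1 i) • Measure.dirac (z i))
      (∑ i, ENNReal.ofReal (w.2 i) • Measure.dirac (z i))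
      (∑ i, ENNReal.ofReal (v.2 i) • Measure.dirac (z i))
    have h3 := htc w.2 v.2
    simp only [abs_sub_comm (w.2 _)] at h3
    rw [ENNReal.ofReal_add (by positivity) (by positivity)]
    calc F v ≤ _ := t1
      _ ≤ _ + (_ + _) := add_le_add (htc v.1 w.1) (t2.trans (add_le_add le_rfl h3))
      _ = _ := by rw [hF]; ring
  have hfin : ∀ w, F w ≠ ∞ := fun w =>
    ne_top_of_le_ne_top ENNReal.ofReal_ne_top (htc w.1 w.2)
  refine continuous_iff_continuousAt.2 fun w => ?_
  have hdist : Tendsto (fun v : stdSimplex ℝ ι × stdSimplex ℝ ι =>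
      ∑ i, |v.1 i - w.1 i| + ∑ i, |v.2 i - w.2 i|) (𝓝 w) (𝓝 0) := by
    have : Continuous fun v : stdSimplex ℝ ι × stdSimplex ℝ ι =>
        ∑ i, |v.1 i - w.1 i| + ∑ i, |v.2 i - w.2 i| := by
      have h1 : ∀ i, Continuous fun v : stdSimplex ℝ ι × stdSimplex ℝ ι => v.1 i := fun i =>
        (continuous_apply i).comp (continuous_subtype_val.comp continuous_fst)
      have h2 : ∀ i, Continuous fun v : stdSimplex ℝ ι × stdSimplex ℝ ι => v.2 i := fun i =>
        (continuous_apply i).comp (continuous_subtype_val.comp continuous_snd)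
      fun_prop
    convert this.tendsto w using 2
    simp
  refine tendsto_iff_dist_tendsto_zero.2 (squeeze_zero (fun _ => dist_nonneg) (fun v => ?_) hdist)
  have key : ∀ v w, (F v).toReal ≤ (F w).toReal +
      (∑ i, |v.1 i - w.1 i| + ∑ i, |v.2 i - w.2 i|) := fun v w => by
    have := ENNReal.toReal_mono (by simp [hfin]) (hle v w)
    rwa [ENNReal.toReal_add (hfin _) ENNReal.ofReal_ne_top,
      ENNReal.toReal_ofReal (by positivity)] at this
  rw [Real.dist_eq, abs_le]
  have h1 := key v w
  have h2 := key w v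
  simp only [abs_sub_comm (w.1 _), abs_sub_comm (w.2 _)] at h2
  constructor <;> linarith

/-- After a push-forward by a simple function, only the masses of finitely many fibres matter. The
cost is continuous in them, and each is measurable in the measure. -/
theorem measurable_W1_map_simpleFunc (T : SimpleFunc E E) :
    Measurable fun p : ProbabilityMeasure E × ProbabilityMeasure E =>
      W1 (p.1.map T.measurable.aemeasurable) (p.2.map T.measurable.aemeasurable) := by
  have hone : ∀ μ : ProbabilityMeasure E,
      (fun a : T.range => (μ : Measure E).real (T ⁻¹' {(a : E)})) ∈ stdSimplex ℝ T.range := by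
    refine fun μ => ⟨fun _ => measureReal_nonneg, ?_⟩
    have h := congrArg (fun ν : Measure E => ν Set.univ) (map_simpleFunc_eq (μ : Measure E) T)
    simp only [Measure.finsetSum_apply, Measure.smul_apply, measure_univ, smul_eq_mul, mul_one,
      Measure.map_apply T.measurable MeasurableSet.univ, Set.preimage_univ] at h
    simp only [Measure.real]
    rw [← ENNReal.toReal_sum fun _ _ => measure_ne_top _ _, ← h, ENNReal.toReal_one]
  let w : ProbabilityMeasure E → stdSimplex ℝ T.range := fun μ => ⟨_, hone μ⟩
  have hw : Measurable w := by
    refine Measurable.subtype_mk (measurable_pi_lambda _ fun a => ?_)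
    exact ((Measure.measurable_coe (T.measurableSet_fiber _)).comp
      measurable_subtype_coe).ennreal_toReal
  have hm := (((continuous_transportCost_sum_dirac fun a : T.range => (a : E)).measurable).comp
    (hw.prodMap hw)).ennreal_ofReal
  convert hm using 1
  ext p
  have e : ∀ μ : ProbabilityMeasure E,
      ((μ.map T.measurable.aemeasurable : ProbabilityMeasure E) : Measure E) =
        ∑ a : T.range, ENNReal.ofReal (w μ a) • Measure.dirac (a : E) := fun μ => by
    rw [ProbabilityMeasure.toMeasure_map, map_simpleFunc_eq]
    refine Finset.sum_congr rfl fun a _ => ?_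
    congr 1
    exact (ENNReal.ofReal_toReal (measure_ne_top _ _)).symm
  have h1 := W1_le_one (p.1.map T.measurable.aemeasurable) (p.2.map T.measurable.aemeasurable)
  rw [← ENNReal.ofReal_toReal (ne_top_of_le_ne_top ENNReal.one_ne_top h1), W1, e, e]
  rfl

/-- Simple functions `T n` converge pointwise to the identity, so by dominated convergence moving a
measure along `T n` has vanishing cost. By the triangle inequality `W1` is a pointwise limit of the
functions in `measurable_W1_map_simpleFunc`. This is what allows `W1` to be integrated against laws
on `𝐏(E)` by change of variables. -/
theorem measurable_W1 : Measurable fun p : ProbabilityMeasure E × ProbabilityMeasure E =>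
    W1 p.1 p.2 := by
  rcases isEmpty_or_nonempty E with h | ⟨⟨x₀⟩⟩
  · have : IsEmpty (ProbabilityMeasure E) :=
      ⟨fun μ => not_isEmpty_iff.2 (nonempty_of_probabilityMeasure μ) h⟩
    exact Subsingleton.measurable
  let T : ℕ → SimpleFunc E E := fun n =>
    SimpleFunc.approxOn id measurable_id Set.univ x₀ (Set.mem_univ _) n
  have hT : ∀ x, Tendsto (fun n => T n x) atTop (𝓝 x) := fun x =>
    SimpleFunc.tendsto_approxOn measurable_id (Set.mem_univ x₀) (by simp)
  have herr : ∀ μ : ProbabilityMeasure E,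
      Tendsto (fun n => ∫⁻ x, truncDist x (T n x) ∂(μ : Measure E)) atTop (𝓝 0) := by
    intro μ
    have : ∫⁻ _, 0 ∂(μ : Measure E) = 0 := lintegral_zero
    rw [← this]
    refine tendsto_lintegral_of_dominated_convergence (fun _ => 1)
      (fun n => measurable_id.truncDist (T n).measurable)
      (fun n => Eventually.of_forall fun x => truncDist_le_one _ _) (by simp)
      (Eventually.of_forall fun x => ?_)
    refine tendsto_of_tendsto_of_tendsto_of_le_of_le tendsto_const_nhds
      (tendsto_iff_edist_tendsto_0.1 (hT x)) (fun _ => zero_le) fun n => ?_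
    rw [edist_comm]
    exact min_le_left _ _
  refine measurable_of_tendsto_metrizable (fun n => measurable_W1_map_simpleFunc (T n)) ?_
  rw [tendsto_pi_nhds]
  rintro ⟨μ, ν⟩
  have hε : Tendsto (fun n => ∫⁻ x, truncDist x (T n x) ∂(μ : Measure E) +
      ∫⁻ x, truncDist x (T n x) ∂(ν : Measure E)) atTop (𝓝 0) := by
    simpa using (herr μ).add (herr ν)
  have hW : W1 μ ν ≠ ∞ := ne_top_of_le_ne_top ENNReal.one_ne_top (W1_le_one μ ν)
  have hlow := ENNReal.Tendsto.sub (tendsto_const_nhds (x := W1 μ ν) (f := atTop)) hε (Or.inl hW)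
  have hup := (tendsto_const_nhds (x := W1 μ ν) (f := atTop)).add hε
  rw [tsub_zero] at hlow
  rw [add_zero] at hup
  refine tendsto_of_tendsto_of_tendsto_of_le_of_le hlow hup (fun n => ?_) fun n => ?_
  · rw [tsub_le_iff_right]
    have h1 := W1_triangle μ (μ.map (T n).measurable.aemeasurable) ν
    have h2 := W1_triangle (μ.map (T n).measurable.aemeasurable)
      (ν.map (T n).measurable.aemeasurable) ν
    have h3 := W1_map_le μ (T n).measurable
    have h4 := W1_map_le ν (T n).measurable
    rw [W1_comm] at h4
    calc W1 μ ν ≤ _ := h1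
      _ ≤ _ + (_ + _) := add_le_add h3 (h2.trans (add_le_add le_rfl h4))
      _ = _ := by ring
  · have h1 := W1_triangle (μ.map (T n).measurable.aemeasurable) μ
      (ν.map (T n).measurable.aemeasurable)
    have h2 := W1_triangle μ ν (ν.map (T n).measurable.aemeasurable)
    have h3 := W1_map_le μ (T n).measurable
    have h4 := W1_map_le ν (T n).measurable
    rw [W1_comm] at h3
    calc _ ≤ _ := h1
      _ ≤ _ + (_ + _) := add_le_add h3 (h2.trans (add_le_add le_rfl h4))
      _ = _ := by ring

end W1

/-! ### Transport to a Dirac mass and the formula for `Ω_∞`. -/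

theorem eq_prod_dirac_of_snd_eq_dirac {X Y : Type*} [MeasurableSpace X] [MeasurableSpace Y]
    {π : Measure (X × Y)} [IsFiniteMeasure π] {y : Y} (h : π.snd = Measure.dirac y) :
    π = π.fst.prod (Measure.dirac y) := by
  refine (Measure.prod_eq fun s t hs ht => ?_).symm
  have key : ∀ t : Set Y, MeasurableSet t → y ∉ t → π (s ×ˢ t) = 0 := fun t ht hy => by
    refine measure_mono_null (t := Prod.snd ⁻¹' t) (fun p hp => hp.2) ?_
    rw [← Measure.snd_apply ht, h, Measure.dirac_apply' _ ht, Set.indicator_of_notMem hy]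
  by_cases hy : y ∈ t
  · rw [Measure.dirac_apply' _ ht, Set.indicator_of_mem hy, Pi.one_apply, mul_one,
      Measure.fst_apply hs, ← Set.prod_univ, ← Set.union_compl_self t, Set.prod_union,
      measure_union _ (hs.prod ht.compl), key _ ht.compl (by simpa using hy), add_zero]
    exact Set.Disjoint.set_prod_right disjoint_compl_right _ _
  · rw [key t ht hy, Measure.dirac_apply' _ ht, Set.indicator_of_notMem hy, mul_zero]

theorem transportCost_dirac {X : Type*} [MeasurableSpace X] {c : X → X → ℝ≥0∞}
    (hc : Measurable fun p : X × X => c p.1 p.2) (μ : Measure X) [IsProbabilityMeasure μ] (x : X) :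
    transportCost c μ (Measure.dirac x) = ∫⁻ y, c y x ∂μ := by
  have key : ∫⁻ p, c p.1 p.2 ∂(μ.prod (Measure.dirac x)) = ∫⁻ y, c y x ∂μ := by
    rw [Measure.prod_dirac, lintegral_map hc (by fun_prop)]
  refine le_antisymm ?_ (le_transportCost fun π h1 h2 => ?_)
  · rw [← key]
    exact transportCost_le (by simp) (by simp)
  · have : IsFiniteMeasure π := ⟨by rw [← Measure.fst_univ, h1]; exact measure_lt_top _ _⟩
    rw [eq_prod_dirac_of_snd_eq_dirac h2, h1, key]

section OmegaInf

variable {E : Type*} [PseudoEMetricSpace E] [MeasurableSpace E] [BorelSpace E]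
  [SecondCountableTopology E] [StandardBorelSpace E]

theorem measurable_W1_left (f : ProbabilityMeasure E) :
    Measurable fun ρ : ProbabilityMeasure E => W1 ρ f := by
  have h : Measurable fun ρ : ProbabilityMeasure E => (ρ, f) := measurable_prodMk_right
  have h' := Measurable.comp measurable_W1 h
  simp only [Function.comp_def] at h'
  exact h'

theorem OmegaInf_eq_lintegral {N : ℕ} (hN : 1 ≤ N) (G : ProbabilityMeasure (Fin N → E))
    (f : ProbabilityMeasure E) :
    OmegaInf hN G f = ∫⁻ z, W1 (empiricalMeasure hN z) f ∂(G : Measure (Fin N → E)) := by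
  change transportCost W1 ((G : Measure (Fin N → E)).map (empiricalMeasure hN))
    (Measure.dirac f) = _
  have : IsProbabilityMeasure ((G : Measure (Fin N → E)).map (empiricalMeasure hN)) :=
    Measure.isProbabilityMeasure_map (measurable_empiricalMeasure hN).aemeasurable
  rw [transportCost_dirac measurable_W1]
  exact lintegral_map (measurable_W1_left f) (measurable_empiricalMeasure hN)

theorem measurable_W1_empiricalMeasure {N : ℕ} (hN : 1 ≤ N) (f : ProbabilityMeasure E) :
    Measurable fun z => W1 (empiricalMeasure hN z) f :=
  (measurable_W1_left f).comp (measurable_empiricalMeasure hN)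

theorem OmegaInf_le_one {N : ℕ} (hN : 1 ≤ N) (G : ProbabilityMeasure (Fin N → E))
    (f : ProbabilityMeasure E) : OmegaInf hN G f ≤ 1 := by
  rw [OmegaInf_eq_lintegral]
  exact (lintegral_mono (g := fun _ => 1) fun z => W1_le_one _ _).trans (by simp)

end OmegaInf

/-! ### Marginals of symmetric laws and of tensor powers. -/

section Marginals

variable {E : Type*} [MeasurableSpace E]

/-- Every injection of the first `j` indices extends to a permutation of all `N`. -/
theorem IsSymmetricMeasure.map_comp_embedding {j N : ℕ} {G : ProbabilityMeasure (Fin N → E)}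
    (hG : IsSymmetricMeasure G) (h : j ≤ N) {e : Fin j → Fin N} (he : Function.Injective e) :
    (G : Measure (Fin N → E)).map (fun x i => x (e i)) =
      (marginal h G : Measure (Fin j → E)) := by
  obtain ⟨σ, hσ⟩ : ∃ σ : Equiv.Perm (Fin N), ∀ i, σ (Fin.castLE h i) = e i := by
    have := Equiv.Perm.isMultiplyPretransitive (Fin N) j
    obtain ⟨σ, hσ⟩ := MulAction.exists_smul_eq (Equiv.Perm (Fin N))
      (Fin.castLEEmb h : Fin j ↪ Fin N) ⟨e, he⟩
    exact ⟨σ, fun i => congrArg (fun g : Fin j ↪ Fin N => g i) hσ⟩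
  rw [marginal, ProbabilityMeasure.toMeasure_map]
  conv_rhs => rw [← hG σ]
  rw [Measure.map_map (by fun_prop) (by fun_prop)]
  simp only [Function.comp_def, hσ]

theorem tensorPow_map_comp_embedding (f : ProbabilityMeasure E) {j N : ℕ} {e : Fin j → Fin N}
    (he : Function.Injective e) :
    (tensorPow f N : Measure (Fin N → E)).map (fun x i => x (e i)) =
      (tensorPow f j : Measure (Fin j → E)) := by
  refine (Measure.pi_eq fun s hs => ?_).symm
  have hpre : (fun (x : Fin N → E) i => x (e i)) ⁻¹' (Set.univ.pi s) =
      Set.univ.pi (Function.extend e s fun _ => Set.univ) := by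
    ext x
    simp only [Set.mem_preimage, Set.mem_univ_pi]
    refine ⟨fun h n => ?_, fun h i => by simpa [he.extend_apply] using h (e i)⟩
    by_cases hn : ∃ i, e i = n
    · obtain ⟨i, rfl⟩ := hn
      simpa [he.extend_apply] using h i
    · simp [Function.extend_apply' _ _ _ hn]
  rw [Measure.map_apply (by fun_prop) (MeasurableSet.univ_pi hs), hpre]
  refine (Measure.pi_pi _ _).trans (Fintype.prod_of_injective e he _ _ (fun n hn => ?_)
    fun i => ?_).symm
  · rw [Function.extend_apply' _ _ _ hn, measure_univ]
  · rw [he.extend_apply]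

theorem isSymmetricMeasure_tensorPow (f : ProbabilityMeasure E) (N : ℕ) :
    IsSymmetricMeasure (tensorPow f N) :=
  fun σ => tensorPow_map_comp_embedding f σ.injective

theorem marginal_tensorPow (f : ProbabilityMeasure E) {j N : ℕ} (h : j ≤ N) :
    marginal h (tensorPow f N) = tensorPow f j :=
  Subtype.ext (tensorPow_map_comp_embedding f (Fin.castLE_injective h))

theorem marginal_self {N : ℕ} (G : ProbabilityMeasure (Fin N → E)) :
    marginal le_rfl G = G := by
  apply Subtype.ext
  change Measure.map _ _ = _
  simp

theorem marginal_marginal {i j N : ℕ} (hij : i ≤ j) (h : j ≤ N)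
    (G : ProbabilityMeasure (Fin N → E)) :
    marginal hij (marginal h G) = marginal (hij.trans h) G := by
  apply Subtype.ext
  change Measure.map _ (Measure.map _ _) = Measure.map _ _
  rw [Measure.map_map (by fun_prop) (by fun_prop)]
  rfl

theorem IsSymmetricMeasure.marginal {j N : ℕ} {G : ProbabilityMeasure (Fin N → E)}
    (hG : IsSymmetricMeasure G) (h : j ≤ N) : IsSymmetricMeasure (marginal h G) := by
  intro σ
  rw [← hG.map_comp_embedding h (Fin.castLE_injective h), Measure.map_map (by fun_prop)
    (by fun_prop), hG.map_comp_embedding h (Fin.castLE_injective h)]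
  exact hG.map_comp_embedding h ((Fin.castLE_injective h).comp σ.injective)

end Marginals

/-! ### Optimal matchings by permutations. -/

section Permutations

/-- On a finite set with uniform measure, transport is at least as costly as some permutation. -/
theorem exists_perm_le_transportCost {N : ℕ} (hN : 1 ≤ N) (c : Fin N → Fin N → ℝ≥0∞) :
    ∃ σ : Equiv.Perm (Fin N), (N : ℝ≥0∞)⁻¹ * ∑ i, c i (σ i) ≤
      transportCost c ((N : ℝ≥0∞)⁻¹ • Measure.count) ((N : ℝ≥0∞)⁻¹ • Measure.count) := by
  obtain ⟨σ₀, hσ₀⟩ := Finite.exists_min fun σ : Equiv.Perm (Fin N) => ∑ i, c i (σ i)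
  refine ⟨σ₀, le_transportCost fun π h1 h2 => ?_⟩
  have hN0 : (N : ℝ≥0∞) ≠ 0 := by exact_mod_cast (by omega : N ≠ 0)
  have hNt : (N : ℝ≥0∞) ≠ ∞ := ENNReal.natCast_ne_top N
  have hrow : ∀ i, ∑ j, π {(i, j)} = (N : ℝ≥0∞)⁻¹ := fun i => by
    have h := congrArg (fun μ : Measure (Fin N) => μ {i}) h1
    simp only [Measure.fst_apply (measurableSet_singleton i), Measure.smul_apply,
      Measure.count_singleton, smul_eq_mul, mul_one] at h
    rw [← h, ← Finset.sum_image (f := fun p => π {p}) (g := fun j => (i, j))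
        (Prod.mk_right_injective i).injOn,
      sum_measure_singleton]
    congr 1
    ext p
    simp [Prod.ext_iff, eq_comm]
  have hcol : ∀ j, ∑ i, π {(i, j)} = (N : ℝ≥0∞)⁻¹ := fun j => by
    have h := congrArg (fun μ : Measure (Fin N) => μ {j}) h2
    simp only [Measure.snd_apply (measurableSet_singleton j), Measure.smul_apply,
      Measure.count_singleton, smul_eq_mul, mul_one] at h
    rw [← h, ← Finset.sum_image (f := fun p => π {p}) (g := fun i => (i, j))
        (Prod.mk_left_injective j).injOn,
      sum_measure_singleton]
    congr 1
    ext p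
    simp [Prod.ext_iff, eq_comm]
  have hfin : ∀ i j, π {(i, j)} ≠ ∞ := fun i j => by
    refine ne_top_of_le_ne_top (ENNReal.inv_ne_top.2 hN0) ?_
    rw [← hrow i]
    exact Finset.single_le_sum (f := fun j => π {(i, j)}) (fun _ _ => zero_le)
      (Finset.mem_univ j)
  let P : Matrix (Fin N) (Fin N) ℝ := fun i j => (N * π {(i, j)}).toReal
  have hP : P ∈ doublyStochastic ℝ (Fin N) := by
    rw [mem_doublyStochastic_iff_sum]
    refine ⟨fun i j => ENNReal.toReal_nonneg, fun i => ?_, fun j => ?_⟩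
    · rw [← ENNReal.toReal_sum fun j _ => ENNReal.mul_ne_top hNt (hfin i j), ← Finset.mul_sum,
        hrow, ENNReal.mul_inv_cancel hN0 hNt, ENNReal.toReal_one]
    · rw [← ENNReal.toReal_sum fun i _ => ENNReal.mul_ne_top hNt (hfin i j), ← Finset.mul_sum,
        hcol, ENNReal.mul_inv_cancel hN0 hNt, ENNReal.toReal_one]
  -- Birkhoff's theorem: `N` times a coupling matrix is a convex combination of permutation
  -- matrices. Its cost is thus an average of permutation costs, hence at least the smallest one.
  obtain ⟨w, hw0, hw1, hw⟩ := exists_eq_sum_perm_of_mem_doublyStochastic hP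
  have hπ : ∀ i j, π {(i, j)} =
      (N : ℝ≥0∞)⁻¹ * ∑ σ : Equiv.Perm (Fin N), if σ i = j then ENNReal.ofReal (w σ) else 0 := by
    intro i j
    have h := congrFun (congrFun hw i) j
    have h' : ∑ σ : Equiv.Perm (Fin N), (if σ i = j then w σ else 0) = P i j := by
      rw [← h, Matrix.sum_apply]
      refine Finset.sum_congr rfl fun σ _ => ?_
      simp [Equiv.Perm.permMatrix, PEquiv.toMatrix_apply, eq_comm]
    have h2 : (∑ σ : Equiv.Perm (Fin N), if σ i = j then ENNReal.ofReal (w σ) else 0) =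
        N * π {(i, j)} := by
      rw [← ENNReal.ofReal_toReal (ENNReal.mul_ne_top hNt (hfin i j))]
      change _ = ENNReal.ofReal (P i j)
      rw [← h', ENNReal.ofReal_sum_of_nonneg fun σ _ => by split_ifs <;> simp [hw0]]
      refine Finset.sum_congr rfl fun σ _ => ?_
      split_ifs <;> simp
    rw [h2, ← mul_assoc, ENNReal.inv_mul_cancel hN0 hNt, one_mul]
  have hone : ∑ σ, ENNReal.ofReal (w σ) = 1 := by
    rw [← ENNReal.ofReal_sum_of_nonneg fun σ _ => hw0 σ, hw1, ENNReal.ofReal_one]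
  calc (N : ℝ≥0∞)⁻¹ * ∑ i, c i (σ₀ i)
      = (N : ℝ≥0∞)⁻¹ * ∑ σ, ENNReal.ofReal (w σ) * ∑ i, c i (σ₀ i) := by
        rw [← Finset.sum_mul, hone, one_mul]
    _ ≤ (N : ℝ≥0∞)⁻¹ * ∑ σ, ENNReal.ofReal (w σ) * ∑ i, c i (σ i) := by
        exact mul_le_mul' le_rfl (Finset.sum_le_sum fun σ _ => mul_le_mul' le_rfl (hσ₀ σ))
    _ = ∑ i, ∑ j, c i j * π {(i, j)} := by
        simp_rw [hπ, Finset.mul_sum]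
        rw [Finset.sum_comm]
        refine Finset.sum_congr rfl fun i _ => ?_
        rw [Finset.sum_comm]
        refine Finset.sum_congr rfl fun σ _ => ?_
        rw [Finset.sum_eq_single (σ i) (fun j _ hj => by simp [hj.symm]) (by simp)]
        simp
        ring
    _ = ∫⁻ p, c p.1 p.2 ∂π := by
        rw [lintegral_fintype, Fintype.sum_prod_type]

/-- Induction on the set of candidates: a new candidate replaces the current minimiser exactly on
the measurable set where it costs no more. This yields optimal matchings that depend measurably on
the configurations. -/
theorem exists_measurable_argmin {ι Y : Type*} [Finite ι] [Nonempty ι] [MeasurableSpace Y]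
    {c : Y → ι → ℝ≥0∞} (hc : ∀ i, Measurable fun y => c y i) :
    ∃ τ : Y → ι, (∀ t, MeasurableSet (τ ⁻¹' {t})) ∧ ∀ y i, c y (τ y) ≤ c y i := by
  classical
  cases nonempty_fintype ι
  suffices h : ∀ s : Finset ι, s.Nonempty →
      ∃ τ : Y → ι, (∀ t, MeasurableSet (τ ⁻¹' {t})) ∧ ∀ y, ∀ i ∈ s, c y (τ y) ≤ c y i by
    obtain ⟨τ, h1, h2⟩ := h Finset.univ Finset.univ_nonempty
    exact ⟨τ, h1, fun y i => h2 y i (Finset.mem_univ i)⟩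
  intro s hs
  induction hs using Finset.Nonempty.cons_induction with
  | singleton a => exact ⟨fun _ => a, fun t => MeasurableSet.const _, fun y i hi => by
      rw [Finset.mem_singleton.1 hi]⟩
  | cons a s ha hs ih =>
    obtain ⟨τ, h1, h2⟩ := ih
    have hτ : Measurable fun y => c y (τ y) := by
      let _ : MeasurableSpace ι := ⊤
      have hτ' : Measurable τ := measurable_to_countable' h1
      have : Measurable fun q : Y × ι => c q.1 q.2 :=
        measurable_from_prod_countable_left hc
      exact this.comp (measurable_id.prodMk hτ')
    have hA : MeasurableSet {y | c y a ≤ c y (τ y)} := measurableSet_le (hc a) hτ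
    refine ⟨fun y => if c y a ≤ c y (τ y) then a else τ y, fun t => ?_, fun y i hi => ?_⟩
    · have : (fun y => if c y a ≤ c y (τ y) then a else τ y) ⁻¹' {t} =
          ({y | c y a ≤ c y (τ y)} ∩ {_y | a = t}) ∪
            ({y | c y a ≤ c y (τ y)}ᶜ ∩ τ ⁻¹' {t}) := by
        ext y
        by_cases hy : c y a ≤ c y (τ y) <;> simp [hy]
      rw [this]
      exact (hA.inter (MeasurableSet.const _)).union (hA.compl.inter (h1 t))
    · rcases Finset.mem_cons.1 hi with rfl | hi
      · simp only
        split_ifs with h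
        exacts [le_rfl, (not_le.1 h).le]
      · simp only
        split_ifs with h
        exacts [h.trans (h2 y i hi), h2 y i hi]

end Permutations

/-- An empirical measure is an image of the uniform measure on indices, so `transportCost_comp_le`
brings transport back to the index set, where permutations suffice. -/
theorem empiricalMeasure_eq_map {E : Type*} [MeasurableSpace E] {N : ℕ} (hN : 1 ≤ N) (x : Fin N → E) :
    (empiricalMeasure hN x : Measure E) = ((N : ℝ≥0∞)⁻¹ • Measure.count).map x := by
  ext s hs
  rw [Measure.map_apply (measurable_of_finite x) hs]
  simp only [empiricalMeasure, ProbabilityMeasure.coe_mk, Measure.smul_apply,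
    Measure.finsetSum_apply, smul_eq_mul]
  congr 1
  rw [Measure.count, Measure.sum_fintype, Measure.finsetSum_apply]
  refine Finset.sum_congr rfl fun i _ => ?_
  rw [Measure.dirac_apply' _ hs, Measure.dirac_apply' _ (measurable_of_finite x hs)]
  rfl

/-! ### Comparison of `Ω_j`, `Ω_N` and `Ω_∞`. -/

section Comparison

theorem OmegaFin_tensorPow {E : Type*} [PseudoEMetricSpace E] [MeasurableSpace E] {j N : ℕ}
    (h : j ≤ N) (f : ProbabilityMeasure E) :
    OmegaFin h (tensorPow f N) f = 0 := by
  have := transportCost_map_le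
    (c := fun x y : Fin j → E => (j : ℝ≥0∞)⁻¹ * ∑ i, truncDist (x i) (y i))
    (tensorPow f j : Measure (Fin j → E)) measurable_id measurable_id
  rw [OmegaFin, marginal_tensorPow, W1Pow]
  simpa [truncDist_self] using this

variable {E : Type*} [PseudoEMetricSpace E] [MeasurableSpace E] [BorelSpace E]
  [SecondCountableTopology E]

/-- By symmetry each cyclic block of `j` indices extracted from a coupling of `G` and `F` couples
their `j`-marginals. Over the `l` shifts every index is used exactly `j` times, which matches the
two normalisations. -/
theorem W1Pow_marginal_le {j l : ℕ} (hj : 1 ≤ j) (h : j ≤ l) {G F : ProbabilityMeasure (Fin l → E)}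
    (hG : IsSymmetricMeasure G) (hF : IsSymmetricMeasure F) :
    W1Pow (marginal h G) (marginal h F) ≤ W1Pow G F := by
  refine le_transportCost fun π h1 h2 => ?_
  have : NeZero l := ⟨by omega⟩
  have hl0 : (l : ℝ≥0∞) ≠ 0 := by exact_mod_cast (by omega : l ≠ 0)
  have hj0 : (j : ℝ≥0∞) ≠ 0 := by exact_mod_cast (by omega : j ≠ 0)
  have hk : ∀ k : Fin l, W1Pow (marginal h G) (marginal h F) ≤
      ∫⁻ p, (j : ℝ≥0∞)⁻¹ * ∑ i, truncDist (p.1 (Fin.castLE h i + k)) (p.2 (Fin.castLE h i + k))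
        ∂π := fun k => by
    -- Addition in `Fin l` is modulo `l`, so a shifted block wraps around without repetition.
    have hinj : Function.Injective fun i : Fin j => Fin.castLE h i + k :=
      (add_left_injective k).comp (Fin.castLE_injective h)
    have e1 : π.map (fun p i => p.1 (Fin.castLE h i + k)) =
        (marginal h G : Measure (Fin j → E)) := by
      rw [← hG.map_comp_embedding h hinj, ← h1, Measure.fst, Measure.map_map (by fun_prop)
        (by fun_prop)]
      rfl
    have e2 : π.map (fun p i => p.2 (Fin.castLE h i + k)) =
        (marginal h F : Measure (Fin j → E)) := by
      rw [← hF.map_comp_embedding h hinj, ← h2, Measure.snd, Measure.map_map (by fun_prop)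
        (by fun_prop)]
      rfl
    rw [W1Pow, ← e1, ← e2]
    exact transportCost_map_le π (by fun_prop) (by fun_prop)
  have hsum : (l : ℝ≥0∞) * W1Pow (marginal h G) (marginal h F) ≤
      ∫⁻ p, ∑ i, truncDist (p.1 i) (p.2 i) ∂π := by
    calc (l : ℝ≥0∞) * W1Pow (marginal h G) (marginal h F)
        = ∑ _k : Fin l, W1Pow (marginal h G) (marginal h F) := by simp
      _ ≤ ∑ k : Fin l, ∫⁻ p, (j : ℝ≥0∞)⁻¹ * ∑ i,
          truncDist (p.1 (Fin.castLE h i + k)) (p.2 (Fin.castLE h i + k)) ∂π :=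
        Finset.sum_le_sum fun k _ => hk k
      _ = ∫⁻ p, ∑ i, truncDist (p.1 i) (p.2 i) ∂π := by
        rw [← lintegral_finsetSum _ fun k _ => by fun_prop]
        refine lintegral_congr fun p => ?_
        rw [← Finset.mul_sum, Finset.sum_comm]
        have : ∀ i : Fin j, ∑ k : Fin l,
            truncDist (p.1 (Fin.castLE h i + k)) (p.2 (Fin.castLE h i + k)) =
            ∑ i, truncDist (p.1 i) (p.2 i) := fun i =>
          Equiv.sum_comp (Equiv.addLeft (Fin.castLE h i)) fun n => truncDist (p.1 n) (p.2 n)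
        simp only [this, Finset.sum_const, Finset.card_univ, Fintype.card_fin, nsmul_eq_mul]
        rw [← mul_assoc, ENNReal.inv_mul_cancel hj0 (ENNReal.natCast_ne_top j), one_mul]
  rw [lintegral_const_mul _ (by fun_prop)]
  calc W1Pow (marginal h G) (marginal h F)
      = (l : ℝ≥0∞)⁻¹ * (l * W1Pow (marginal h G) (marginal h F)) := by
        rw [← mul_assoc, ENNReal.inv_mul_cancel hl0 (ENNReal.natCast_ne_top l), one_mul]
    _ ≤ _ := by gcongr

theorem OmegaFin_mono {i j N : ℕ} (hi : 1 ≤ i) (hij : i ≤ j) (h : j ≤ N)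
    {G : ProbabilityMeasure (Fin N → E)} (hG : IsSymmetricMeasure G)
    (f : ProbabilityMeasure E) : OmegaFin (hij.trans h) G f ≤ OmegaFin h G f := by
  have := W1Pow_marginal_le hi hij (hG.marginal h) (isSymmetricMeasure_tensorPow f j)
  rwa [marginal_marginal, marginal_tensorPow] at this

theorem OmegaFin_le_W1Pow {j N : ℕ} (hj : 1 ≤ j) (h : j ≤ N) {G : ProbabilityMeasure (Fin N → E)}
    (hG : IsSymmetricMeasure G) (f : ProbabilityMeasure E) :
    OmegaFin h G f ≤ W1Pow G (tensorPow f N) := by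
  have := OmegaFin_mono hj h le_rfl hG f
  rwa [OmegaFin, OmegaFin, marginal_self] at this

variable [StandardBorelSpace E]

theorem exists_perm_le_W1_empiricalMeasure {N : ℕ} (hN : 1 ≤ N) (x y : Fin N → E) :
    ∃ σ : Equiv.Perm (Fin N), (N : ℝ≥0∞)⁻¹ * ∑ i, truncDist (x i) (y (σ i)) ≤
      W1 (empiricalMeasure hN x) (empiricalMeasure hN y) := by
  have : Nonempty E := ⟨x ⟨0, hN⟩⟩
  have : Nonempty (Fin N) := ⟨⟨0, hN⟩⟩
  have : IsFiniteMeasure ((N : ℝ≥0∞)⁻¹ • (Measure.count : Measure (Fin N))) := by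
    refine Measure.smul_finite _ (ENNReal.inv_ne_top.2 ?_)
    exact_mod_cast (by omega : N ≠ 0)
  obtain ⟨σ, hσ⟩ := exists_perm_le_transportCost hN fun i j => truncDist (x i) (y j)
  refine ⟨σ, hσ.trans ?_⟩
  rw [W1, empiricalMeasure_eq_map, empiricalMeasure_eq_map]
  exact transportCost_comp_le (c := truncDist) (by fun_prop) _ (measurable_of_finite x)
    (measurable_of_finite y)

/-- Transport between symmetric laws is dominated by transport between empirical measures. -/
theorem W1Pow_le_lintegral_W1_empiricalMeasure {N : ℕ} (hN : 1 ≤ N)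
    {G F : ProbabilityMeasure (Fin N → E)} (hG : IsSymmetricMeasure G)
    (hF : IsSymmetricMeasure F) :
    W1Pow G F ≤ ∫⁻ p, W1 (empiricalMeasure hN p.1) (empiricalMeasure hN p.2)
      ∂((G : Measure (Fin N → E)).prod (F : Measure (Fin N → E))) := by
  set Q := (G : Measure (Fin N → E)).prod (F : Measure (Fin N → E)) with hQ
  obtain ⟨τ, hτm, hτ⟩ := exists_measurable_argmin (ι := Equiv.Perm (Fin N))
    (c := fun (p : (Fin N → E) × (Fin N → E)) σ => ∑ i, truncDist (p.1 i) (p.2 (σ i)))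
    fun σ => by fun_prop
  have hτ' : ∀ p : (Fin N → E) × (Fin N → E), (N : ℝ≥0∞)⁻¹ * ∑ i, truncDist (p.1 i) (p.2 (τ p i)) ≤
      W1 (empiricalMeasure hN p.1) (empiricalMeasure hN p.2) := fun p => by
    obtain ⟨σ, hσ⟩ := exists_perm_le_W1_empiricalMeasure hN p.1 p.2
    exact (mul_le_mul' le_rfl (hτ p σ)).trans hσ
  have hT : ∀ σ : Equiv.Perm (Fin N),
      Measurable fun (p : (Fin N → E) × (Fin N → E)) i => p.2 (τ p (σ i)) := fun σ => by
    let _ : MeasurableSpace (Equiv.Perm (Fin N)) := ⊤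
    have h1 : Measurable τ := measurable_to_countable' hτm
    have h2 : Measurable fun q : ((Fin N → E) × (Fin N → E)) × Equiv.Perm (Fin N) =>
        fun i => q.1.2 (q.2 (σ i)) :=
      measurable_from_prod_countable_left fun ρ => by
        change Measurable fun p : (Fin N → E) × (Fin N → E) => fun i => p.2 (ρ (σ i))
        fun_prop
    exact h2.comp (measurable_id.prodMk h1)
  let n : ℝ≥0∞ := Fintype.card (Equiv.Perm (Fin N))
  have hn0 : n ≠ 0 := by simp [n]
  have hnt : n ≠ ∞ := ENNReal.natCast_ne_top _
  have hconst : ∀ a : ℝ≥0∞, n⁻¹ * ∑ _σ : Equiv.Perm (Fin N), a = a := fun a => by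
    rw [Finset.sum_const, nsmul_eq_mul, ← mul_assoc, Finset.card_univ,
      ENNReal.inv_mul_cancel hn0 hnt, one_mul]
  -- Matching by `τ p` alone would distort the law of the second component, since `τ` depends on
  -- `p`. Both configurations are therefore relabelled by a common uniform `σ`, which leaves the
  -- cost unchanged.
  let Φ : Equiv.Perm (Fin N) → (Fin N → E) × (Fin N → E) → (Fin N → E) × (Fin N → E) :=
    fun σ p => (fun i => p.1 (σ i), fun i => p.2 (τ p (σ i)))
  have hΦ : ∀ σ, Measurable (Φ σ) := fun σ => Measurable.prodMk (by fun_prop) (hT σ)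
  refine (transportCost_le (π := n⁻¹ • ∑ σ, Q.map (Φ σ)) ?_ ?_).trans ?_
  · ext s hs
    rw [Measure.fst_apply hs]
    simp only [Measure.smul_apply, Measure.finsetSum_apply, smul_eq_mul]
    have : ∀ σ, Q.map (Φ σ) (Prod.fst ⁻¹' s) = (G : Measure (Fin N → E)) s := fun σ => by
      conv_rhs => rw [← hG σ]
      rw [Measure.map_apply (hΦ σ) (measurable_fst hs), Measure.map_apply (by fun_prop) hs]
      have e : Φ σ ⁻¹' (Prod.fst ⁻¹' s) = ((fun x : Fin N → E => fun i => x (σ i)) ⁻¹' s) ×ˢ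
          Set.univ := by ext p; simp [Φ]
      rw [e, hQ, Measure.prod_prod, measure_univ, mul_one]
    simp only [this, hconst]
  · ext s hs
    rw [Measure.snd_apply hs]
    simp only [Measure.smul_apply, Measure.finsetSum_apply, smul_eq_mul]
    have h1 : ∀ σ, Q.map (Φ σ) (Prod.snd ⁻¹' s) =
        ∫⁻ p, s.indicator 1 (fun i => p.2 (τ p (σ i))) ∂Q := fun σ => by
      rw [Measure.map_apply (hΦ σ) (measurable_snd hs), ← lintegral_indicator_one
        ((hΦ σ) (measurable_snd hs))]
      rfl
    have h2 : ∀ σ : Equiv.Perm (Fin N),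
        ∫⁻ p, s.indicator 1 (fun i => p.2 (σ i)) ∂Q = (F : Measure (Fin N → E)) s := fun σ => by
      have hm : Measurable fun (y : Fin N → E) i => y (σ i) := by fun_prop
      conv_rhs => rw [← hF σ, Measure.map_apply hm hs, ← lintegral_indicator_one (hm hs)]
      rw [← Measure.snd_prod (μ := (G : Measure (Fin N → E))) (ν := (F : Measure (Fin N → E))),
        Measure.snd, lintegral_map (measurable_one.indicator (hm hs)) measurable_snd]
      rfl
    have hind : Measurable (s.indicator (1 : (Fin N → E) → ℝ≥0∞)) := measurable_one.indicator hs
    simp only [h1]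
    have hm1 : ∀ σ : Equiv.Perm (Fin N), Measurable fun p : (Fin N → E) × (Fin N → E) =>
        s.indicator (1 : (Fin N → E) → ℝ≥0∞) (fun i => p.2 (τ p (σ i))) :=
      fun σ => hind.comp (hT σ)
    have hm2 : ∀ σ : Equiv.Perm (Fin N), Measurable fun p : (Fin N → E) × (Fin N → E) =>
        s.indicator (1 : (Fin N → E) → ℝ≥0∞) (fun i => p.2 (σ i)) :=
      fun σ => hind.comp (by fun_prop)
    rw [← lintegral_finsetSum _ fun σ _ => hm1 σ]
    -- For fixed `p`, the product `τ p * σ` runs over all permutations along with `σ`; the sum no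
    -- longer sees `τ`, and symmetry of `F` applies.
    have h3 : ∀ p : (Fin N → E) × (Fin N → E),
        ∑ σ : Equiv.Perm (Fin N), s.indicator (1 : (Fin N → E) → ℝ≥0∞)
          (fun i => p.2 (τ p (σ i))) =
        ∑ σ : Equiv.Perm (Fin N), s.indicator 1 (fun i => p.2 (σ i)) := fun p =>
      Equiv.sum_comp (Equiv.mulLeft (τ p)) fun σ : Equiv.Perm (Fin N) =>
        s.indicator (1 : (Fin N → E) → ℝ≥0∞) (fun i => p.2 (σ i))
    simp only [h3]
    rw [lintegral_finsetSum _ fun σ _ => hm2 σ]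
    simp only [h2, hconst]
  · rw [lintegral_smul_measure, lintegral_finsetSum_measure, smul_eq_mul]
    have h1 : ∀ σ, ∫⁻ p, (N : ℝ≥0∞)⁻¹ * ∑ i, truncDist (p.1 i) (p.2 i) ∂(Q.map (Φ σ)) ≤
        ∫⁻ p, W1 (empiricalMeasure hN p.1) (empiricalMeasure hN p.2) ∂Q := fun σ => by
      refine (lintegral_map_le _ _).trans (lintegral_mono fun p => ?_)
      refine le_trans (le_of_eq ?_) (hτ' p)
      congr 1
      exact Equiv.sum_comp σ fun i => truncDist (p.1 i) (p.2 (τ p i))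
    exact (mul_le_mul' le_rfl (Finset.sum_le_sum fun σ _ => h1 σ)).trans (hconst _).le

theorem lintegral_prod_fst_add_snd {X : Type*} [MeasurableSpace X] (μ ν : Measure X)
    [IsProbabilityMeasure μ] [IsProbabilityMeasure ν] {h : X → ℝ≥0∞} (hm : Measurable h) :
    ∫⁻ p, h p.1 + h p.2 ∂(μ.prod ν) = ∫⁻ x, h x ∂μ + ∫⁻ x, h x ∂ν := by
  have h1 : Measurable fun p : X × X => h p.1 := hm.comp measurable_fst
  rw [lintegral_add_left h1, ← lintegral_map hm measurable_fst,
    ← lintegral_map hm measurable_snd, Measure.map_fst_prod, Measure.map_snd_prod]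
  simp

/-- Apply the previous comparison to independent configurations and pass through `f` by the triangle
inequality under the integral. -/
theorem W1Pow_le_OmegaInf_add {N : ℕ} (hN : 1 ≤ N) {G : ProbabilityMeasure (Fin N → E)}
    (hG : IsSymmetricMeasure G) (f : ProbabilityMeasure E) :
    W1Pow G (tensorPow f N) ≤ OmegaInf hN G f + OmegaInf hN (tensorPow f N) f := by
  refine (W1Pow_le_lintegral_W1_empiricalMeasure hN hG
    (isSymmetricMeasure_tensorPow f N)).trans ?_
  have hm := measurable_W1_empiricalMeasure hN f
  rw [OmegaInf_eq_lintegral, OmegaInf_eq_lintegral, ← lintegral_prod_fst_add_snd _ _ hm]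
  refine lintegral_mono fun p => ?_
  have := W1_triangle (empiricalMeasure hN p.1) f (empiricalMeasure hN p.2)
  rwa [W1_comm f] at this

end Comparison

/-! ### Discretisation by a partition of unity. -/

section Discretization

variable {E : Type*} [PseudoEMetricSpace E] [MeasurableSpace E] [BorelSpace E]
  [SecondCountableTopology E]

/-- Cost of moving the mass of `μ` to the points `z i` according to a partition of unity. -/
theorem transportCost_partition_le {ι : Type*} [Fintype ι] {φ : ι → E → ℝ≥0∞}
    (hφ : ∀ i, Measurable (φ i)) (hsum : ∀ x, ∑ i, φ i x = 1) (z : ι → E) (μ : Measure E) :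
    transportCost truncDist μ (∑ i, (∫⁻ x, φ i x ∂μ) • Measure.dirac (z i)) ≤
      ∑ i, ∫⁻ x, φ i x * truncDist x (z i) ∂μ := by
  have hm : ∀ i, Measurable fun x : E => (x, z i) := fun i => by fun_prop
  -- The coupling sends `x` to `z i` with probability `φ i x`.
  refine (transportCost_le
    (π := ∑ i, (μ.withDensity (φ i)).map fun x => (x, z i)) ?_ ?_).trans ?_
  · ext s hs
    rw [Measure.fst_apply hs, Measure.finsetSum_apply]
    have : ∀ i, (μ.withDensity (φ i)).map (fun x => (x, z i)) (Prod.fst ⁻¹' s) =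
        ∫⁻ x in s, φ i x ∂μ := fun i => by
      rw [Measure.map_apply (hm i) (measurable_fst hs), ← withDensity_apply _ hs]
      rfl
    simp only [this]
    rw [← lintegral_finsetSum _ fun i _ => hφ i]
    simp [hsum]
  · ext s hs
    rw [Measure.snd_apply hs, Measure.finsetSum_apply, Measure.finsetSum_apply]
    refine Finset.sum_congr rfl fun i _ => ?_
    rw [Measure.map_apply (hm i) (measurable_snd hs), Measure.smul_apply, smul_eq_mul,
      Measure.dirac_apply' _ hs]
    by_cases hz : z i ∈ s
    · have : (fun x : E => (x, z i)) ⁻¹' (Prod.snd ⁻¹' s) = Set.univ := by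
        ext x; simpa using hz
      rw [this, withDensity_apply _ MeasurableSet.univ, Set.indicator_of_mem hz]
      simp
    · have : (fun x : E => (x, z i)) ⁻¹' (Prod.snd ⁻¹' s) = ∅ := by
        ext x; simpa using hz
      rw [this, Set.indicator_of_notMem hz]
      simp
  · rw [lintegral_finsetSum_measure]
    refine Finset.sum_le_sum fun i _ => (lintegral_map_le _ _).trans (le_of_eq ?_)
    rw [lintegral_withDensity_eq_lintegral_mul _ (hφ i) (by fun_prop)]
    rfl

variable [StandardBorelSpace E]

/-- Both measures are discretised with the same partition, and the resulting weights are compared.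
The cell `none` collects what the balls miss; its mass is moved to an arbitrary point at unit cost
at most. -/
theorem W1_le_of_partition {ι : Type*} [Fintype ι] {φ : Option ι → E → ℝ≥0∞}
    (hφ : ∀ i, Measurable (φ i)) (hsum : ∀ x, ∑ i, φ i x = 1) (z : ι → E) {η : ℝ≥0∞}
    (hz : ∀ i x, φ (some i) x ≠ 0 → truncDist x (z i) ≤ η) (μ f : ProbabilityMeasure E) :
    W1 μ f ≤ 2 * η + 2 * ∫⁻ x, φ none x ∂(f : Measure E) +
      2 * ∑ i, (∫⁻ x, φ i x ∂(μ : Measure E) - ∫⁻ x, φ i x ∂(f : Measure E)) := by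
  obtain ⟨x₀⟩ := nonempty_of_probabilityMeasure f
  have : Nonempty E := ⟨x₀⟩
  let z' : Option ι → E := fun i => i.elim x₀ z
  let a : ProbabilityMeasure E → Option ι → ℝ≥0∞ := fun μ i => ∫⁻ x, φ i x ∂(μ : Measure E)
  have ha : ∀ μ : ProbabilityMeasure E, ∑ i, a μ i = 1 := fun μ => by
    rw [← lintegral_finsetSum _ fun i _ => hφ i]
    simp [hsum]
  have hB : ∀ μ : ProbabilityMeasure E,
      ∑ i, ∫⁻ x, φ i x * truncDist x (z' i) ∂(μ : Measure E) ≤ η + a μ none := fun μ => by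
    rw [Fintype.sum_option, add_comm]
    refine add_le_add ?_ (lintegral_mono fun x => mul_le_of_le_one_right' (truncDist_le_one _ _))
    calc ∑ i, ∫⁻ x, φ (some i) x * truncDist x (z' (some i)) ∂(μ : Measure E)
        ≤ ∑ i, a μ (some i) * η := by
          refine Finset.sum_le_sum fun i _ => ?_
          rw [← lintegral_mul_const _ (hφ _)]
          refine lintegral_mono fun x => ?_
          rcases eq_or_ne (φ (some i) x) 0 with h | h
          · simp [h]
          · exact mul_le_mul' le_rfl (hz i x h)
      _ ≤ 1 * η := by
          rw [← Finset.sum_mul, ← ha μ, Fintype.sum_option]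
          exact mul_le_mul' le_add_self le_rfl
      _ = η := one_mul η
  have hD : ∀ μ : ProbabilityMeasure E,
      transportCost truncDist μ (∑ i, a μ i • Measure.dirac (z' i)) ≤ η + a μ none := fun μ =>
    (transportCost_partition_le hφ hsum z' _).trans (hB μ)
  have fin : IsFiniteMeasure (∑ i, a μ i • Measure.dirac (z' i)) := ⟨by
    simp only [Measure.finsetSum_apply, Measure.smul_apply, measure_univ, smul_eq_mul, mul_one]
    rw [ha]
    exact ENNReal.one_lt_top⟩
  have t1 := transportCost_triangle (c := truncDist (E := E)) (by fun_prop) truncDist_triangle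
    μ (∑ i, a μ i • Measure.dirac (z' i)) f
  have t2 := transportCost_triangle (c := truncDist (E := E)) (by fun_prop) truncDist_triangle
    (∑ i, a μ i • Measure.dirac (z' i)) (∑ i, a f i • Measure.dirac (z' i)) f
  have t3 := transportCost_sum_dirac_le (c := truncDist (E := E)) truncDist_self
    truncDist_le_one z' (ha μ) (ha f)
  have t4 := hD f
  rw [transportCost_comm truncDist_comm] at t4
  -- The remainder mass of `μ` is traded for that of `f` and one of the excesses, so that only the
  -- tail of `f` enters.
  have t5 : a μ none ≤ a f none + ∑ i, (a μ i - a f i) := by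
    refine le_add_tsub.trans (add_le_add le_rfl ?_)
    exact Finset.single_le_sum (f := fun i => a μ i - a f i) (fun _ _ => zero_le)
      (Finset.mem_univ none)
  calc W1 μ f ≤ _ := t1
    _ ≤ (η + a μ none) + (∑ i, (a μ i - a f i) + (η + a f none)) :=
      add_le_add (hD μ) (t2.trans (add_le_add t3 t4))
    _ ≤ (η + (a f none + ∑ i, (a μ i - a f i))) +
        (∑ i, (a μ i - a f i) + (η + a f none)) := by gcongr
    _ = _ := by ring

end Discretization

/-! ### The variance estimate by `Ω₂`. -/

section Variance

variable {E : Type*} [MeasurableSpace E]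

theorem integral_mul_tensorPow_two (f : ProbabilityMeasure E) (ψ : E → ℝ) :
    ∫ x, ψ (x 0) * ψ (x 1) ∂(tensorPow f 2 : Measure (Fin 2 → E)) =
      (∫ x, ψ x ∂(f : Measure E)) ^ 2 := by
  have := integral_fintype_prod_eq_pow (ι := Fin 2) (μ := (f : Measure E)) ψ
  simp only [Fin.prod_univ_two, Fintype.card_fin] at this
  exact this

theorem abs_mul_sub_mul_le {a b a' b' : ℝ} (hb : |b| ≤ 1) (ha' : |a'| ≤ 1) :
    |a * b - a' * b'| ≤ |a - a'| + |b - b'| := by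
  have : a * b - a' * b' = (a - a') * b + a' * (b - b') := by ring
  rw [this]
  refine (abs_add_le _ _).trans (add_le_add ?_ ?_)
  · rw [abs_mul]; exact mul_le_of_le_one_right (abs_nonneg _) hb
  · rw [abs_mul]; exact mul_le_of_le_one_left (abs_nonneg _) ha'

/-- Expand the square: the `N` diagonal terms are at most `1`, and by symmetry all off-diagonal
terms equal the same pair correlation. -/
theorem integral_sq_average_le {N : ℕ} (hN : 2 ≤ N) {G : ProbabilityMeasure (Fin N → E)}
    (hG : IsSymmetricMeasure G) {ψ : E → ℝ} (hψ : Measurable ψ) (hψ1 : ∀ x, |ψ x| ≤ 1) :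
    ∫ x, ((N : ℝ)⁻¹ * ∑ i, ψ (x i)) ^ 2 ∂(G : Measure (Fin N → E)) ≤
      (N : ℝ)⁻¹ + |∫ x, ψ (x 0) * ψ (x 1) ∂(marginal hN G : Measure (Fin 2 → E))| := by
  set I := ∫ x, ψ (x 0) * ψ (x 1) ∂(marginal hN G : Measure (Fin 2 → E)) with hI
  have hN0 : (N : ℝ) ≠ 0 := by exact_mod_cast (by omega : N ≠ 0)
  have hb : ∀ i j : Fin N, ∀ x : Fin N → E, |ψ (x i) * ψ (x j)| ≤ 1 := fun i j x => by
    rw [abs_mul]; exact mul_le_one₀ (hψ1 _) (abs_nonneg _) (hψ1 _)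
  have hi : ∀ i j : Fin N,
      Integrable (fun x : Fin N → E => ψ (x i) * ψ (x j)) (G : Measure (Fin N → E)) :=
    fun i j => Integrable.of_bound (Measurable.aestronglyMeasurable (by fun_prop)) 1
      (Eventually.of_forall fun x => by simpa using hb i j x)
  have hterm : ∀ i j : Fin N, ∫ x, ψ (x i) * ψ (x j) ∂(G : Measure (Fin N → E)) ≤
      (if i = j then 1 else 0) + |I| := fun i j => by
    split_ifs with hij
    · have : ∫ x, ψ (x i) * ψ (x j) ∂(G : Measure (Fin N → E)) ≤
          ∫ _, (1 : ℝ) ∂(G : Measure (Fin N → E)) :=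
        integral_mono (hi i j) (integrable_const _) fun x => (abs_le.1 (hb i j x)).2
      rw [integral_const, probReal_univ, one_smul] at this
      linarith [abs_nonneg I]
    · have hinj : Function.Injective (![i, j] : Fin 2 → Fin N) := by
        intro a b hab
        fin_cases a <;> fin_cases b <;> simp_all
      have : I = ∫ x, ψ (x i) * ψ (x j) ∂(G : Measure (Fin N → E)) := by
        rw [hI, ← hG.map_comp_embedding hN hinj, integral_map
          (measurable_pi_lambda _ fun _ => measurable_pi_apply _).aemeasurable
          (Measurable.aestronglyMeasurable (by fun_prop))]
        rfl
      rw [← this, zero_add]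
      exact le_abs_self I
  have hsq : ∀ x : Fin N → E, ((N : ℝ)⁻¹ * ∑ i, ψ (x i)) ^ 2 =
      ((N : ℝ)⁻¹) ^ 2 * ∑ i, ∑ j, ψ (x i) * ψ (x j) := fun x => by
    rw [mul_pow, sq (∑ i, ψ (x i)), Finset.sum_mul_sum]
  simp only [hsq]
  rw [integral_const_mul, integral_finsetSum _ fun i _ => integrable_finsetSum _ fun j _ => hi i j]
  simp only [fun i => integral_finsetSum Finset.univ fun j (_ : j ∈ Finset.univ) => hi i j]
  calc ((N : ℝ)⁻¹) ^ 2 * ∑ i, ∑ j, ∫ x, ψ (x i) * ψ (x j) ∂(G : Measure (Fin N → E))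
      ≤ ((N : ℝ)⁻¹) ^ 2 * ∑ i : Fin N, ∑ j : Fin N, ((if i = j then 1 else 0) + |I|) := by
        gcongr with i _ j _
        exact hterm i j
    _ = (N : ℝ)⁻¹ + |I| := by
        simp [Finset.sum_add_distrib]
        field_simp

variable [PseudoEMetricSpace E]

/-- The correlation of a centred Lipschitz observable is controlled by `Ω₂`. -/
theorem ofReal_abs_integral_mul_le {f : ProbabilityMeasure E} (G : ProbabilityMeasure (Fin 2 → E))
    {ψ : E → ℝ} (hψ : Measurable ψ) (hψ1 : ∀ x, |ψ x| ≤ 1) (h0 : ∫ x, ψ x ∂(f : Measure E) = 0)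
    {L : ℝ≥0∞} (hL0 : L ≠ 0) (hLt : L ≠ ∞)
    (hL : ∀ x y, ENNReal.ofReal |ψ x - ψ y| ≤ L * truncDist x y) :
    ENNReal.ofReal |∫ x, ψ (x 0) * ψ (x 1) ∂(G : Measure (Fin 2 → E))| ≤
      2 * L * W1Pow G (tensorPow f 2) := by
  have h2L0 : 2 * L ≠ 0 := mul_ne_zero two_ne_zero hL0
  have h2Lt : 2 * L ≠ ∞ := ENNReal.mul_ne_top ENNReal.ofNat_ne_top hLt
  -- Dividing by `2 * L` leaves a lower bound for the infimum, to be checked on each coupling.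
  rw [mul_comm, ← ENNReal.div_le_iff h2L0 h2Lt]
  refine le_transportCost fun π h1 h2 => ?_
  rw [ENNReal.div_le_iff h2L0 h2Lt]
  have : IsProbabilityMeasure π := ⟨by rw [← Measure.fst_univ, h1, measure_univ]⟩
  have hb : Measurable fun x : Fin 2 → E => ψ (x 0) * ψ (x 1) := by fun_prop
  have hb1 : ∀ x : Fin 2 → E, |ψ (x 0) * ψ (x 1)| ≤ 1 := fun x => by
    rw [abs_mul]; exact mul_le_one₀ (hψ1 _) (abs_nonneg _) (hψ1 _)
  have hi : ∀ {g : (Fin 2 → E) × (Fin 2 → E) → (Fin 2 → E)}, Measurable g →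
      Integrable (fun p => ψ (g p 0) * ψ (g p 1)) π := fun {g} hg =>
    Integrable.of_bound (hb.comp hg).aestronglyMeasurable 1 (Eventually.of_forall fun p => by
      simpa using hb1 (g p))
  have e1 : ∫ x, ψ (x 0) * ψ (x 1) ∂(G : Measure (Fin 2 → E)) =
      ∫ p, ψ (p.1 0) * ψ (p.1 1) ∂π := by
    rw [← h1, Measure.fst, integral_map (by fun_prop) hb.aestronglyMeasurable]
  have e2 : ∫ p, ψ (p.2 0) * ψ (p.2 1) ∂π = 0 := by
    have := integral_mul_tensorPow_two f ψ
    rw [h0, ← h2, Measure.snd, integral_map (by fun_prop) hb.aestronglyMeasurable] at this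
    simpa using this
  have e3 : ∫ x, ψ (x 0) * ψ (x 1) ∂(G : Measure (Fin 2 → E)) =
      ∫ p, (ψ (p.1 0) * ψ (p.1 1) - ψ (p.2 0) * ψ (p.2 1)) ∂π := by
    rw [integral_sub (hi measurable_fst) (hi measurable_snd), e1, e2, sub_zero]
  rw [e3, ← Real.enorm_eq_ofReal_abs]
  refine (enorm_integral_le_lintegral_enorm _).trans ?_
  rw [mul_comm, ← lintegral_const_mul' _ _ h2Lt]
  refine lintegral_mono fun p => ?_
  rw [Real.enorm_eq_ofReal_abs]
  calc ENNReal.ofReal |ψ (p.1 0) * ψ (p.1 1) - ψ (p.2 0) * ψ (p.2 1)|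
      ≤ ENNReal.ofReal (|ψ (p.1 0) - ψ (p.2 0)| + |ψ (p.1 1) - ψ (p.2 1)|) :=
        ENNReal.ofReal_le_ofReal (abs_mul_sub_mul_le (hψ1 _) (hψ1 _))
    _ ≤ L * truncDist (p.1 0) (p.2 0) + L * truncDist (p.1 1) (p.2 1) := by
        rw [ENNReal.ofReal_add (abs_nonneg _) (abs_nonneg _)]
        exact add_le_add (hL _ _) (hL _ _)
    _ = 2 * L * (((2 : ℕ) : ℝ≥0∞)⁻¹ * ∑ i, truncDist (p.1 i) (p.2 i)) := by
        rw [Fin.sum_univ_two, mul_comm 2 L, mul_assoc, ← mul_assoc 2, Nat.cast_ofNat,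
          ENNReal.mul_inv_cancel two_ne_zero ENNReal.ofNat_ne_top, one_mul, mul_add]

/-- The bound `|h| ≤ s + h² / s` replaces the Cauchy–Schwarz inequality: it is linear in the
variance and leaves `s` free to be chosen later. -/
theorem lintegral_abs_average_sub_le {N : ℕ} (hN : 2 ≤ N) {G : ProbabilityMeasure (Fin N → E)}
    (hG : IsSymmetricMeasure G) (f : ProbabilityMeasure E) {φ : E → ℝ} (hφ : Measurable φ)
    (hφ0 : ∀ x, 0 ≤ φ x) (hφ1 : ∀ x, φ x ≤ 1) {L : ℝ≥0∞} (hL0 : L ≠ 0) (hLt : L ≠ ∞)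
    (hL : ∀ x y, ENNReal.ofReal |φ x - φ y| ≤ L * truncDist x y) {s : ℝ} (hs : 0 < s) :
    ∫⁻ x, ENNReal.ofReal |(N : ℝ)⁻¹ * ∑ i, φ (x i) - ∫ y, φ y ∂(f : Measure E)|
        ∂(G : Measure (Fin N → E)) ≤
      ENNReal.ofReal s + ENNReal.ofReal s⁻¹ * ((N : ℝ≥0∞)⁻¹ + 2 * L * OmegaFin hN G f) := by
  set c := ∫ y, φ y ∂(f : Measure E) with hc
  have hN0 : (N : ℝ) ≠ 0 := by exact_mod_cast (by omega : N ≠ 0)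
  have hint : Integrable φ (f : Measure E) :=
    Integrable.of_bound hφ.aestronglyMeasurable 1 (Eventually.of_forall fun x => by
      simpa [abs_of_nonneg (hφ0 x)] using hφ1 x)
  have hc0 : 0 ≤ c := integral_nonneg hφ0
  have hc1 : c ≤ 1 := by
    have := integral_mono hint (integrable_const (1 : ℝ)) hφ1
    simpa using this
  let ψ : E → ℝ := fun x => φ x - c
  have hψ : Measurable ψ := hφ.sub_const c
  have hψ1 : ∀ x, |ψ x| ≤ 1 := fun x => by
    have := hφ0 x
    have := hφ1 x
    exact abs_le.2 ⟨by simp only [ψ]; linarith, by simp only [ψ]; linarith⟩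
  have hψ0 : ∫ x, ψ x ∂(f : Measure E) = 0 := by
    simp only [ψ]
    rw [integral_sub hint (integrable_const c)]
    simp [hc]
  have havg : ∀ x : Fin N → E, (N : ℝ)⁻¹ * ∑ i, φ (x i) - c = (N : ℝ)⁻¹ * ∑ i, ψ (x i) :=
    fun x => by
      simp only [ψ, Finset.sum_sub_distrib, Finset.sum_const, Finset.card_univ, Fintype.card_fin,
        nsmul_eq_mul]
      field_simp
  simp only [havg]
  have hm : Measurable fun x : Fin N → E => (N : ℝ)⁻¹ * ∑ i, ψ (x i) := by fun_prop
  have hb : ∀ x : Fin N → E, |(N : ℝ)⁻¹ * ∑ i, ψ (x i)| ≤ 1 := fun x => by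
    rw [abs_mul, abs_of_nonneg (by positivity : 0 ≤ (N : ℝ)⁻¹)]
    calc (N : ℝ)⁻¹ * |∑ i, ψ (x i)| ≤ (N : ℝ)⁻¹ * ∑ _i : Fin N, 1 := by
          gcongr
          exact (Finset.abs_sum_le_sum_abs _ _).trans (Finset.sum_le_sum fun i _ => hψ1 _)
      _ = 1 := by simp [hN0]
  have hpt : ∀ h : ℝ, ENNReal.ofReal |h| ≤
      ENNReal.ofReal s + ENNReal.ofReal s⁻¹ * ENNReal.ofReal (h ^ 2) := fun h => by
    rw [← ENNReal.ofReal_mul (by positivity), ← ENNReal.ofReal_add hs.le (by positivity)]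
    refine ENNReal.ofReal_le_ofReal ?_
    rw [← sq_abs h]
    have : 0 ≤ s⁻¹ * (s - |h|) ^ 2 + |h| := by positivity
    have e : s⁻¹ * (s - |h|) ^ 2 = s - 2 * |h| + s⁻¹ * |h| ^ 2 := by field_simp; ring
    linarith
  refine (lintegral_mono fun x => hpt _).trans ?_
  rw [lintegral_add_left measurable_const, lintegral_const, measure_univ, mul_one,
    lintegral_const_mul _ (by fun_prop)]
  gcongr
  rw [← ofReal_integral_eq_lintegral_ofReal
    (Integrable.of_bound (hm.pow_const 2).aestronglyMeasurable 1 (Eventually.of_forall fun x => by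
      simpa using hb x)) (Eventually.of_forall fun x => sq_nonneg _)]
  refine (ENNReal.ofReal_le_ofReal (integral_sq_average_le hN hG hψ hψ1)).trans ?_
  rw [ENNReal.ofReal_add (by positivity) (abs_nonneg _), ENNReal.ofReal_inv_of_pos
    (by positivity), ENNReal.ofReal_natCast]
  gcongr
  exact ofReal_abs_integral_mul_le _ hψ hψ1 hψ0 hL0 hLt fun x y => by
    simpa [ψ] using hL x y

end Variance

/-! ### The bound of `Ω_∞` for a given partition. -/

section Estimate

variable {E : Type*} [PseudoEMetricSpace E] [MeasurableSpace E] [BorelSpace E]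
  [SecondCountableTopology E] [StandardBorelSpace E]

theorem lintegral_empiricalMeasure {E : Type*} [MeasurableSpace E] {N : ℕ} (hN : 1 ≤ N)
    (x : Fin N → E) {g : E → ℝ≥0∞} (hg : Measurable g) :
    ∫⁻ y, g y ∂(empiricalMeasure hN x : Measure E) = (N : ℝ≥0∞)⁻¹ * ∑ i, g (x i) := by
  simp only [empiricalMeasure, ProbabilityMeasure.coe_mk]
  rw [lintegral_smul_measure, lintegral_finsetSum_measure, smul_eq_mul]
  simp only [lintegral_dirac' _ hg]

theorem OmegaInf_le_of_partition {N : ℕ} (hN : 2 ≤ N) {G : ProbabilityMeasure (Fin N → E)}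
    (hG : IsSymmetricMeasure G) (f : ProbabilityMeasure E) {ι : Type*} [Fintype ι]
    {φ : Option ι → E → ℝ} (hφ : ∀ i, Measurable (φ i)) (hφ0 : ∀ i x, 0 ≤ φ i x)
    (hsum : ∀ x, ∑ i, φ i x = 1) (z : ι → E) {η : ℝ≥0∞}
    (hz : ∀ i x, φ (some i) x ≠ 0 → truncDist x (z i) ≤ η) {L : ℝ≥0∞} (hL0 : L ≠ 0)
    (hLt : L ≠ ∞) (hL : ∀ i x y, ENNReal.ofReal |φ i x - φ i y| ≤ L * truncDist x y)
    {s : ℝ} (hs : 0 < s) :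
    OmegaInf (one_le_two.trans hN) G f ≤
      2 * η + 2 * ∫⁻ x, ENNReal.ofReal (φ none x) ∂(f : Measure E) +
      2 * ((Fintype.card ι + 1) * (ENNReal.ofReal s +
        ENNReal.ofReal s⁻¹ * ((N : ℝ≥0∞)⁻¹ + 2 * L * OmegaFin hN G f))) := by
  have hφ1 : ∀ i x, φ i x ≤ 1 := fun i x => by
    rw [← hsum x]
    exact Finset.single_le_sum (f := fun i => φ i x) (fun i _ => hφ0 i x) (Finset.mem_univ i)
  have hsum' : ∀ x, ∑ i, ENNReal.ofReal (φ i x) = 1 := fun x => by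
    rw [← ENNReal.ofReal_sum_of_nonneg fun i _ => hφ0 i x, hsum, ENNReal.ofReal_one]
  have hW := fun x : Fin N → E => W1_le_of_partition (fun i => (hφ i).ennreal_ofReal) hsum' z
    (fun i y h => hz i y fun h' => h (by rw [h', ENNReal.ofReal_zero]))
    (empiricalMeasure (one_le_two.trans hN) x) f
  have hdiff : ∀ i (x : Fin N → E),
      ∫⁻ y, ENNReal.ofReal (φ i y) ∂(empiricalMeasure (one_le_two.trans hN) x : Measure E) -
        ∫⁻ y, ENNReal.ofReal (φ i y) ∂(f : Measure E) ≤
      ENNReal.ofReal |(N : ℝ)⁻¹ * ∑ k, φ i (x k) - ∫ y, φ i y ∂(f : Measure E)| := by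
    intro i x
    have hint : Integrable (φ i) (f : Measure E) :=
      Integrable.of_bound (hφ i).aestronglyMeasurable 1 (Eventually.of_forall fun x => by
        simpa [abs_of_nonneg (hφ0 i x)] using hφ1 i x)
    rw [lintegral_empiricalMeasure _ _ (hφ i).ennreal_ofReal,
      ← ofReal_integral_eq_lintegral_ofReal hint (Eventually.of_forall (hφ0 i)),
      ← ENNReal.ofReal_sum_of_nonneg fun k _ => hφ0 i _, ← ENNReal.ofReal_natCast,
      ← ENNReal.ofReal_inv_of_pos (by exact_mod_cast (by omega : 0 < N)),
      ← ENNReal.ofReal_mul (by positivity), ← ENNReal.ofReal_sub _ (integral_nonneg (hφ0 i))]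
    exact ENNReal.ofReal_le_ofReal (le_abs_self _)
  rw [OmegaInf_eq_lintegral]
  refine (lintegral_mono fun x => (hW x).trans (add_le_add le_rfl (mul_le_mul' le_rfl
    (Finset.sum_le_sum fun i _ => hdiff i x)))).trans ?_
  rw [lintegral_add_left measurable_const, lintegral_const, measure_univ, mul_one]
  gcongr
  have hmeas : ∀ i, Measurable fun x : Fin N → E =>
      ENNReal.ofReal |(N : ℝ)⁻¹ * ∑ k, φ i (x k) - ∫ y, φ i y ∂(f : Measure E)| := fun i => by
    have := hφ i
    fun_prop
  rw [lintegral_const_mul _ (Finset.measurable_sum _ fun i _ => hmeas i),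
    lintegral_finsetSum _ fun i _ => hmeas i]
  refine mul_le_mul' le_rfl ((Finset.sum_le_sum fun i _ =>
    lintegral_abs_average_sub_le hN hG f (hφ i) (hφ0 i) (hφ1 i) hL0 hLt (hL i) hs).trans ?_)
  rw [Finset.sum_const, nsmul_eq_mul, Finset.card_univ, Fintype.card_option]
  push_cast
  exact le_rfl

end Estimate

/-! ### Lipschitz partitions of unity. -/

section Partition

theorem abs_prod_sub_prod_le_sum {ι : Type*} (s : Finset ι) (u v : ι → ℝ) (hu : ∀ i, |u i| ≤ 1)
    (hv : ∀ i, |v i| ≤ 1) : |∏ i ∈ s, u i - ∏ i ∈ s, v i| ≤ ∑ i ∈ s, |u i - v i| := by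
  classical
  induction s using Finset.induction_on with
  | empty => simp
  | insert a s ha ih =>
    rw [Finset.prod_insert ha, Finset.prod_insert ha, Finset.sum_insert ha]
    refine (abs_mul_sub_mul_le ?_ (hv a)).trans (by gcongr)
    rw [Finset.abs_prod]
    exact Finset.prod_le_one (fun i _ => abs_nonneg _) fun i _ => hu i

/-- A partition of unity with controlled Lipschitz constants subordinate to finitely many balls. -/
theorem exists_lipschitz_partition {E : Type*} [PseudoMetricSpace E] {m : ℕ} (z : Fin m → E)
    {ε : ℝ} (hε : 0 < ε) (hε1 : ε ≤ 1) :
    ∃ φ : Option (Fin m) → E → ℝ, (∀ i, Continuous (φ i)) ∧ (∀ i x, 0 ≤ φ i x) ∧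
      (∀ x, ∑ i, φ i x = 1) ∧ (∀ i x, φ (some i) x ≠ 0 → dist x (z i) ≤ 2 * ε) ∧
      (∀ x i, dist x (z i) ≤ ε → φ none x = 0) ∧
      ∀ i x y, |φ i x - φ i y| ≤ (m + 1) / ε * min (dist x y) 1 := by
  -- Tents equal to `1` within `ε` of `z i`, vanishing beyond `2 * ε`, with Lipschitz constant `1 /
  -- ε`.
  let ψ : Fin m → E → ℝ := fun i x => max 0 (min 1 (2 - dist x (z i) / ε))
  have hψc : ∀ i, Continuous (ψ i) := fun i => by simp only [ψ]; fun_prop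
  have hψ0 : ∀ i x, 0 ≤ ψ i x := fun i x => le_max_left _ _
  have hψ1 : ∀ i x, ψ i x ≤ 1 := fun i x => max_le zero_le_one (min_le_left _ _)
  have hψL : ∀ i x y, |ψ i x - ψ i y| ≤ dist x y / ε := fun i x y => by
    refine (abs_max_sub_max_le_max _ _ _ _).trans ?_
    rw [sub_self, abs_zero]
    refine max_le (by positivity) ((abs_min_sub_min_le_max _ _ _ _).trans ?_)
    rw [sub_self, abs_zero]
    refine max_le (by positivity) ?_
    have : 2 - dist x (z i) / ε - (2 - dist y (z i) / ε) = (dist y (z i) - dist x (z i)) / ε := by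
      ring
    rw [this, abs_div, abs_of_pos hε, dist_comm x y]
    gcongr
    exact abs_dist_sub_le _ _ _
  have h1ψ : ∀ i x, 0 ≤ 1 - ψ i x := fun i x => sub_nonneg.2 (hψ1 i x)
  have h1ψ' : ∀ i x, |1 - ψ i x| ≤ 1 := fun i x => by
    rw [abs_of_nonneg (h1ψ i x)]; linarith [hψ0 i x]
  have hψabs : ∀ i x, |ψ i x| ≤ 1 := fun i x => by
    rw [abs_of_nonneg (hψ0 i x)]; exact hψ1 i x
  have hprodL : ∀ (s : Finset (Fin m)) x y,
      |∏ j ∈ s, (1 - ψ j x) - ∏ j ∈ s, (1 - ψ j y)| ≤ m * (dist x y / ε) := fun s x y => by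
    refine (abs_prod_sub_prod_le_sum s _ _ (fun j => h1ψ' j x) fun j => h1ψ' j y).trans ?_
    refine (Finset.sum_le_card_nsmul s _ (dist x y / ε) fun j _ => ?_).trans ?_
    · rw [sub_sub_sub_cancel_left, abs_sub_comm]
      exact hψL j x y
    · rw [nsmul_eq_mul]
      gcongr
      simpa using Finset.card_le_univ s
  have hprod0 : ∀ (s : Finset (Fin m)) x, 0 ≤ ∏ j ∈ s, (1 - ψ j x) := fun s x =>
    Finset.prod_nonneg fun j _ => h1ψ j x
  have hprod1 : ∀ (s : Finset (Fin m)) x, |∏ j ∈ s, (1 - ψ j x)| ≤ 1 := fun s x => by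
    rw [Finset.abs_prod]
    exact Finset.prod_le_one (fun j _ => abs_nonneg _) fun j _ => h1ψ' j x
  -- Each tent takes its share of what the earlier ones left, and `none` keeps the remainder. The
  -- sum telescopes to `1`, and no division by `∑ ψ` can spoil the Lipschitz constants.
  let φ : Option (Fin m) → E → ℝ := fun i x =>
    i.elim (∏ j, (1 - ψ j x)) fun i => ψ i x * ∏ j with j < i, (1 - ψ j x)
  have hφ0 : ∀ i x, 0 ≤ φ i x := fun i x => by
    cases i with
    | none => exact hprod0 _ x
    | some i => exact mul_nonneg (hψ0 i x) (hprod0 _ x)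
  have hsum : ∀ x, ∑ i, φ i x = 1 := fun x => by
    rw [Fintype.sum_option]
    change ∏ j, (1 - ψ j x) + ∑ i, ψ i x * ∏ j with j < i, (1 - ψ j x) = 1
    rw [Finset.prod_one_sub_ordered]
    ring
  refine ⟨φ, fun i => ?_, hφ0, hsum, fun i x h => ?_, fun x i h => ?_, fun i x y => ?_⟩
  · cases i with
    | none => exact continuous_finsetProd _ fun j _ => continuous_const.sub (hψc j)
    | some i =>
      exact (hψc i).mul (continuous_finsetProd _ fun j _ => continuous_const.sub (hψc j))
  · by_contra! hlt
    refine h (mul_eq_zero_of_left (max_eq_left ((min_le_right _ _).trans ?_)) _)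
    have : 2 < dist x (z i) / ε := (lt_div_iff₀ hε).2 hlt
    linarith
  · refine Finset.prod_eq_zero (Finset.mem_univ i) ?_
    have : dist x (z i) / ε ≤ 1 := (div_le_one hε).2 h
    have h1 : ψ i x = 1 := by
      simp only [ψ]
      rw [min_eq_left (by linarith), max_eq_right zero_le_one]
    rw [h1, sub_self]
  · have hφ1 : ∀ x, φ i x ≤ 1 := fun x => by
      rw [← hsum x]
      exact Finset.single_le_sum (f := fun i => φ i x) (fun i _ => hφ0 i x) (Finset.mem_univ i)
    have hL1 : 1 ≤ (m + 1) / ε := by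
      rw [one_le_div hε]
      have : (0 : ℝ) ≤ m := Nat.cast_nonneg m
      linarith
    have hdist : |φ i x - φ i y| ≤ (m + 1) / ε * dist x y := by
      have e : (m + 1) / ε * dist x y = dist x y / ε + m * (dist x y / ε) := by ring
      rw [e]
      have : 0 ≤ dist x y / ε := by positivity
      cases i with
      | none =>
        have := hprodL Finset.univ x y
        change |∏ j, (1 - ψ j x) - ∏ j, (1 - ψ j y)| ≤ _
        linarith
      | some i =>
        exact (abs_mul_sub_mul_le (hprod1 _ x) (hψabs i y)).trans
          (add_le_add (hψL i x y) (hprodL _ x y))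
    rcases le_total (dist x y) 1 with h | h
    · rwa [min_eq_left h]
    · rw [min_eq_right h, mul_one]
      refine le_trans ?_ hL1
      rw [abs_le]
      constructor <;> linarith [hφ0 i x, hφ0 i y, hφ1 x, hφ1 y]

end Partition

/-! ### From `Ω₂` to `Ω_∞` by finite families of balls. -/

section Covering

variable {E : Type*} [PseudoMetricSpace E] [MeasurableSpace E] [BorelSpace E]
  [SecondCountableTopology E]

theorem truncDist_eq_ofReal {E : Type*} [PseudoMetricSpace E] (x y : E) :
    truncDist x y = ENNReal.ofReal (min (dist x y) 1) := by
  rw [truncDist, edist_dist, ENNReal.ofReal_min, ENNReal.ofReal_one]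

/-- Comparison of `Ω_∞` with `Ω₂` in terms of a finite family of `ε`-balls. -/
theorem OmegaInf_le_of_covering [StandardBorelSpace E] {N : ℕ} (hN : 2 ≤ N)
    {G : ProbabilityMeasure (Fin N → E)}
    (hG : IsSymmetricMeasure G) (f : ProbabilityMeasure E) {m : ℕ} (z : Fin m → E) {ε : ℝ}
    (hε : 0 < ε) (hε1 : ε ≤ 1) :
    OmegaInf (one_le_two.trans hN) G f ≤
      ENNReal.ofReal (6 * ε) + 2 * (f : Measure E) {x | ∀ i, ε < dist x (z i)} +
      ENNReal.ofReal (4 * (m + 1) ^ 3 / ε ^ 2) * ((N : ℝ≥0∞)⁻¹ + OmegaFin hN G f) := by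
  obtain ⟨φ, hφc, hφ0, hsum, hz, hnone, hL⟩ := exists_lipschitz_partition z hε hε1
  have hm0 : (0 : ℝ) < m + 1 := by positivity
  have hLpos : 0 < (m + 1) / ε := by positivity
  have hL1 : 1 ≤ (m + 1) / ε := by
    rw [one_le_div hε]
    have : (0 : ℝ) ≤ m := Nat.cast_nonneg m
    linarith
  -- With `η = 2ε` and `s = ε / (m + 1)`, the errors are `4ε` from the discretisation and `2ε` from
  -- the `m + 1` cells. The remaining factor is `2(m + 1) · (m + 1)/ε · 2(m + 1)/ε`, after `1 / N`
  -- too is multiplied by `2L ≥ 1`.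
  have key := OmegaInf_le_of_partition hN hG f (fun i => (hφc i).measurable) hφ0 hsum z
    (η := ENNReal.ofReal (2 * ε)) (fun i x h => ?_) (L := ENNReal.ofReal ((m + 1) / ε))
    (by simpa using hLpos) ENNReal.ofReal_ne_top (fun i x y => ?_)
    (s := ε / (m + 1)) (by positivity)
  rotate_left
  · rw [truncDist_eq_ofReal]
    exact ENNReal.ofReal_le_ofReal ((min_le_left _ _).trans (hz i x h))
  · rw [truncDist_eq_ofReal, ← ENNReal.ofReal_mul hLpos.le]
    exact ENNReal.ofReal_le_ofReal (hL i x y)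
  refine key.trans ?_
  have hset : MeasurableSet {x | ∀ i, ε < dist x (z i)} := by
    have : {x | ∀ i, ε < dist x (z i)} = ⋂ i, {x | ε < dist x (z i)} := by ext; simp
    rw [this]
    exact MeasurableSet.iInter fun i => measurableSet_lt measurable_const (by fun_prop)
  have htail : ∫⁻ x, ENNReal.ofReal (φ none x) ∂(f : Measure E) ≤
      (f : Measure E) {x | ∀ i, ε < dist x (z i)} := by
    rw [← lintegral_indicator_one hset]
    refine lintegral_mono fun x => ?_
    by_cases hx : x ∈ {x | ∀ i, ε < dist x (z i)}
    · rw [Set.indicator_of_mem hx, Pi.one_apply, ← ENNReal.ofReal_one, ← hsum x]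
      exact ENNReal.ofReal_le_ofReal (Finset.single_le_sum (f := fun i => φ i x)
        (fun i _ => hφ0 i x) (Finset.mem_univ none))
    · simp only [Set.mem_ofPred_eq, not_forall, not_lt] at hx
      obtain ⟨i, hi⟩ := hx
      simp [hnone x i hi]
  have hcard : ((Fintype.card (Fin m) : ℝ≥0∞) + 1) = ENNReal.ofReal (m + 1) := by
    rw [ENNReal.ofReal_add (Nat.cast_nonneg m) zero_le_one, ENNReal.ofReal_natCast,
      ENNReal.ofReal_one, Fintype.card_fin]
  have h2L : 1 ≤ 2 * ENNReal.ofReal ((m + 1) / ε) := by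
    have := ENNReal.ofReal_le_ofReal hL1
    rw [ENNReal.ofReal_one] at this
    calc (1 : ℝ≥0∞) ≤ 1 * 1 := by simp
      _ ≤ _ := mul_le_mul' one_le_two this
  have h2 : ∀ a : ℝ, 2 * ENNReal.ofReal a = ENNReal.ofReal (2 * a) := fun a => by
    rw [ENNReal.ofReal_mul zero_le_two, ENNReal.ofReal_ofNat]
  calc _ ≤ 2 * ENNReal.ofReal (2 * ε) + 2 * (f : Measure E) {x | ∀ i, ε < dist x (z i)} +
        2 * (ENNReal.ofReal (m + 1) * (ENNReal.ofReal (ε / (m + 1)) +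
          ENNReal.ofReal (ε / (m + 1))⁻¹ * (2 * ENNReal.ofReal ((m + 1) / ε) * (N : ℝ≥0∞)⁻¹ +
            2 * ENNReal.ofReal ((m + 1) / ε) * OmegaFin hN G f))) := by
        rw [hcard]
        gcongr
        exact le_mul_of_one_le_left' h2L
    _ = (2 * ENNReal.ofReal (2 * ε) +
          2 * (ENNReal.ofReal (m + 1) * ENNReal.ofReal (ε / (m + 1)))) +
        2 * (f : Measure E) {x | ∀ i, ε < dist x (z i)} +
        (2 * (ENNReal.ofReal (m + 1) * (ENNReal.ofReal (ε / (m + 1))⁻¹ *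
          (2 * ENNReal.ofReal ((m + 1) / ε))))) * ((N : ℝ≥0∞)⁻¹ + OmegaFin hN G f) := by ring
    _ = _ := by
        rw [← ENNReal.ofReal_mul hm0.le, h2, h2, h2, ← ENNReal.ofReal_mul (by positivity),
          ← ENNReal.ofReal_mul hm0.le, h2, ← ENNReal.ofReal_add (by positivity) (by positivity)]
        congr 3
        · field_simp; ring
        · field_simp; ring

/-- Tightness, in terms of finite families of `ε`-balls. -/
theorem exists_covering_measure_le (f : ProbabilityMeasure E) {ε : ℝ} (hε : 0 < ε) {δ : ℝ≥0∞}
    (hδ : 0 < δ) : ∃ (m : ℕ) (z : Fin m → E),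
      (f : Measure E) {x | ∀ i, ε < dist x (z i)} ≤ δ := by
  have := nonempty_of_probabilityMeasure f
  let u := TopologicalSpace.denseSeq E
  let A : ℕ → Set E := fun m => {x | ∀ i : Fin m, ε < dist x (u i)}
  have hA : ∀ m, MeasurableSet (A m) := fun m => by
    have : A m = ⋂ i : Fin m, {x | ε < dist x (u i)} := by ext; simp [A]
    rw [this]
    exact MeasurableSet.iInter fun i => measurableSet_lt measurable_const (by fun_prop)
  -- The complements of the first `m` balls around a dense sequence decrease to the empty set.
  have hanti : Antitone A := fun m n hmn x hx i => hx ⟨i, i.2.trans_le hmn⟩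
  have hempty : ⋂ m, A m = ∅ := by
    refine Set.eq_empty_of_forall_notMem fun x hx => ?_
    obtain ⟨n, hn⟩ := (TopologicalSpace.denseRange_denseSeq E).exists_dist_lt x hε
    exact absurd (Set.mem_iInter.1 hx (n + 1) ⟨n, n.lt_succ_self⟩) (not_lt.2 hn.le)
  have ht := tendsto_measure_iInter_atTop (μ := (f : Measure E))
    (fun m => (hA m).nullMeasurableSet) hanti ⟨0, measure_ne_top _ _⟩
  rw [hempty, measure_empty] at ht
  obtain ⟨m, hm⟩ := ((ENNReal.tendsto_nhds_zero.1 ht) δ hδ).exists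
  exact ⟨m, fun i => u i, hm⟩

end Covering

/-! ### Nets of polynomial size. -/

section Nets

variable {V : Type*} [NormedAddCommGroup V] [NormedSpace ℝ V] [ProperSpace V]

/-- By compactness `P` balls of radius `1 / 2` cover the unit ball. Rescaling this cover inside
every ball of the current net halves the radius and multiplies the cardinality by at most `P`. -/
theorem exists_dyadic_net : ∃ P : ℕ, ∀ (n : ℕ) (R : ℝ), 0 < R →
    ∃ s : Finset V, s.card ≤ P ^ n ∧ ∀ x : V, ‖x‖ ≤ R → ∃ c ∈ s, dist x c ≤ R / 2 ^ n := by
  classical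
  obtain ⟨t, -, htf, ht⟩ := (isCompact_closedBall (0 : V) 1).finite_cover_balls
    (e := 1 / 2) (by norm_num)
  lift t to Finset V using htf
  refine ⟨t.card, fun n R hR => ?_⟩
  induction n with
  | zero => exact ⟨{0}, by simp, fun x hx => ⟨0, by simp, by simpa using hx⟩⟩
  | succ n ih =>
    obtain ⟨s, hs, hsR⟩ := ih
    set r := R / 2 ^ n with hr
    have hr0 : 0 < r := by positivity
    refine ⟨Finset.image₂ (fun c w => c + r • w) s t, ?_, fun x hx => ?_⟩
    · exact (Finset.card_image₂_le _ _ _).trans (by rw [pow_succ]; gcongr)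
    · obtain ⟨c, hc, hxc⟩ := hsR x hx
      have hmem : r⁻¹ • (x - c) ∈ Metric.closedBall (0 : V) 1 := by
        rw [mem_closedBall_zero_iff, norm_smul, norm_inv, Real.norm_of_nonneg hr0.le,
          ← dist_eq_norm, inv_mul_le_one₀ hr0]
        exact hxc
      obtain ⟨w, hw, hxw⟩ := Set.mem_iUnion₂.1 (ht hmem)
      refine ⟨c + r • w, Finset.mem_image₂_of_mem hc hw, ?_⟩
      have e : x - (c + r • w) = r • (r⁻¹ • (x - c) - w) := by
        rw [smul_sub, smul_inv_smul₀ hr0.ne']; abel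
      rw [dist_eq_norm, e, norm_smul, Real.norm_of_nonneg hr0.le, ← dist_eq_norm]
      calc r * dist (r⁻¹ • (x - c)) w ≤ r * (1 / 2) := by
            gcongr; exact (Metric.mem_ball.1 hxw).le
        _ = R / 2 ^ (n + 1) := by rw [hr, pow_succ]; field_simp

variable (V) in
/-- Balls of radius `ε⁻¹` have `ε`-nets of cardinality polynomial in `ε⁻¹`. -/
theorem exists_polynomial_net : ∃ (p : ℕ) (C : ℝ), 0 < C ∧ ∀ ε : ℝ, 0 < ε → ε ≤ 1 →
    ∃ (m : ℕ) (z : Fin m → V), (∀ x : V, ‖x‖ ≤ ε⁻¹ → ∃ i, dist x (z i) ≤ ε) ∧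
      (m : ℝ) ≤ C * (ε⁻¹) ^ p := by
  obtain ⟨P, hP⟩ := exists_dyadic_net (V := V)
  refine ⟨2 * P, 2 ^ P, by positivity, fun ε hε hε1 => ?_⟩
  have h1 : 1 ≤ ε⁻¹ := (one_le_inv₀ hε).2 hε1
  -- Here `2 ^ n ≤ ε⁻² < 2 ^ (n + 1)`, so `n + 1` halvings bring the radius from `ε⁻¹` down to at
  -- most `ε`.
  obtain ⟨n, hn1, hn2⟩ := exists_nat_pow_near (one_le_pow₀ h1 : 1 ≤ (ε⁻¹) ^ 2) one_lt_two
  obtain ⟨s, hs, hnet⟩ := hP (n + 1) ε⁻¹ (by positivity)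
  refine ⟨s.card, fun i => s.equivFin.symm i, fun x hx => ?_, ?_⟩
  · obtain ⟨c, hc, hxc⟩ := hnet x hx
    refine ⟨s.equivFin ⟨c, hc⟩, ?_⟩
    simp only [Equiv.symm_apply_apply]
    refine hxc.trans ((div_le_iff₀ (by positivity)).2 ?_)
    calc ε⁻¹ = ε * (ε⁻¹) ^ 2 := by field_simp
      _ ≤ ε * 2 ^ (n + 1) := by gcongr
  · calc (s.card : ℝ) ≤ (P : ℝ) ^ (n + 1) := by exact_mod_cast hs
      -- The crude bound `P ≤ 2 ^ P` turns the cardinality into a power of `2 ^ (n + 1) ≤ 2ε⁻²`,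
      -- with no logarithm.
      _ ≤ (2 ^ P) ^ (n + 1) := by
          gcongr
          exact_mod_cast (Nat.lt_two_pow_self).le
      _ = (2 ^ (n + 1)) ^ P := by rw [← pow_mul, ← pow_mul, mul_comm]
      _ ≤ (2 * (ε⁻¹) ^ 2) ^ P := by
          gcongr
          rw [pow_succ, mul_comm]
          gcongr
      _ = 2 ^ P * (ε⁻¹) ^ (2 * P) := by rw [mul_pow, ← pow_mul]

end Nets

/-! ### Equivalence of the convergences. -/

section Equivalence

/-- Since `Ω_j` only makes sense for `N ≥ j`, the convergences live on different index types; this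
form lets them be compared. -/
theorem tendsto_Ici_zero_iff {j : ℕ} {F : Set.Ici j → ℝ≥0∞} :
    Tendsto F atTop (𝓝 0) ↔ ∀ ε > 0, ∃ n, ∀ N : Set.Ici j, n ≤ (N : ℕ) → F N ≤ ε := by
  rw [ENNReal.tendsto_nhds_zero]
  refine forall₂_congr fun ε hε => ?_
  rw [eventually_atTop]
  exact ⟨fun ⟨a, ha⟩ => ⟨a, fun N hN => ha N hN⟩, fun ⟨n, hn⟩ =>
    ⟨⟨max j n, Set.mem_Ici.2 (le_max_left _ _)⟩, fun N hN => hn N ((le_max_right j n).trans hN)⟩⟩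

variable {E : Type*} [PseudoMetricSpace E] [MeasurableSpace E] [BorelSpace E]
  [SecondCountableTopology E] [StandardBorelSpace E]

/-- The balls are chosen from `f` alone, by tightness. Their number, hence the constant in front of
`1 / N + Ω₂`, does not depend on `N`. -/
theorem tendsto_OmegaInf_of_tendsto_OmegaFin_two (f : ProbabilityMeasure E)
    {G : ∀ N : ℕ, ProbabilityMeasure (Fin N → E)} (hG : ∀ N, IsSymmetricMeasure (G N))
    (h : Tendsto (fun N : Set.Ici 2 => OmegaFin N.2 (G N) f) atTop (𝓝 0)) :
    Tendsto (fun N : Set.Ici 1 => OmegaInf N.2 (G N) f) atTop (𝓝 0) := by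
  rw [tendsto_Ici_zero_iff]
  intro e he
  rcases eq_or_ne e ∞ with rfl | het
  · exact ⟨0, fun _ _ => le_top⟩
  have h2 : 0 < e / 2 := ENNReal.div_pos he.ne' ENNReal.ofNat_ne_top
  have h4 : 0 < e / 2 / 2 := ENNReal.div_pos h2.ne' ENNReal.ofNat_ne_top
  have h4t : e / 2 / 2 ≠ ∞ := ENNReal.div_ne_top (ENNReal.div_ne_top het two_ne_zero) two_ne_zero
  set r := (e / 2 / 2).toReal with hr
  have hr0 : 0 < r := ENNReal.toReal_pos h4.ne' h4t
  -- Budget: `e / 4` for `6ε`, `e / 4` for twice the tail, and `e / 2` for the term that vanishes as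
  -- `N → ∞`.
  set ε := min 1 (r / 6) with hε
  have hε0 : 0 < ε := by positivity
  obtain ⟨m, z, hz⟩ := exists_covering_measure_le f hε0 (δ := e / 2 / 2 / 2)
    (ENNReal.div_pos h4.ne' ENNReal.ofNat_ne_top)
  set K := ENNReal.ofReal (4 * (m + 1) ^ 3 / ε ^ 2) with hK
  have hlim : Tendsto (fun N : Set.Ici 2 => K * (((N : ℕ) : ℝ≥0∞)⁻¹ + OmegaFin N.2 (G N) f))
      atTop (𝓝 0) := by
    have h1 : Tendsto (fun N : Set.Ici 2 => ((N : ℕ) : ℝ≥0∞)⁻¹) atTop (𝓝 0) :=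
      ENNReal.tendsto_inv_nat_nhds_zero.comp (tendsto_comp_val_Ici_atTop.2 tendsto_id)
    have := ENNReal.Tendsto.const_mul (a := K) (h1.add h) (Or.inr ENNReal.ofReal_ne_top)
    simpa using this
  obtain ⟨n, hn⟩ := tendsto_Ici_zero_iff.1 hlim (e / 2) h2
  refine ⟨max 2 n, fun N hN => ?_⟩
  have hN2 : 2 ≤ (N : ℕ) := (le_max_left 2 n).trans hN
  have hb := OmegaInf_le_of_covering hN2 (hG N) f z hε0 (min_le_left _ _)
  have hn' := hn ⟨N, hN2⟩ ((le_max_right 2 n).trans hN)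
  have h6 : ENNReal.ofReal (6 * ε) ≤ e / 2 / 2 := by
    rw [← ENNReal.ofReal_toReal h4t]
    refine ENNReal.ofReal_le_ofReal ?_
    have : ε ≤ r / 6 := min_le_right _ _
    linarith
  calc OmegaInf N.2 (G N) f ≤ _ := hb
    _ ≤ e / 2 / 2 + 2 * (e / 2 / 2 / 2) + e / 2 := by gcongr
    _ = e := by
      rw [ENNReal.mul_div_cancel two_ne_zero ENNReal.ofNat_ne_top, ENNReal.add_halves,
        ENNReal.add_halves]

theorem tfae_tendsto_Omega (f : ProbabilityMeasure E)
    (G : ∀ N : ℕ, ProbabilityMeasure (Fin N → E)) (hG : ∀ N, IsSymmetricMeasure (G N)) :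
    List.TFAE [
      ∃ j : ℕ, 2 ≤ j ∧ Tendsto (fun N : Set.Ici j => OmegaFin N.2 (G N) f) atTop (𝓝 0),
      ∀ j : ℕ, 2 ≤ j → Tendsto (fun N : Set.Ici j => OmegaFin N.2 (G N) f) atTop (𝓝 0),
      Tendsto (fun N : Set.Ici 1 => OmegaInf N.2 (G N) f) atTop (𝓝 0),
      Tendsto (fun N : ℕ => W1Pow (G N) (tensorPow f N)) atTop (𝓝 0)] := by
  tfae_have 2 → 1 := fun h => ⟨2, le_rfl, h 2 le_rfl⟩
  tfae_have 1 → 3 := by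
    rintro ⟨j, hj, h⟩
    refine tendsto_OmegaInf_of_tendsto_OmegaFin_two f hG ?_
    rw [tendsto_Ici_zero_iff] at h ⊢
    intro ε hε
    obtain ⟨n, hn⟩ := h ε hε
    refine ⟨max j n, fun N hN => ?_⟩
    have hjN : j ≤ (N : ℕ) := (le_max_left j n).trans hN
    exact (OmegaFin_mono one_le_two hj hjN (hG N) f).trans
      (hn ⟨N, hjN⟩ ((le_max_right j n).trans hN))
  tfae_have 3 → 4 := by
    intro h
    have h0 : Tendsto (fun N : Set.Ici 1 => OmegaInf N.2 (tensorPow f N) f) atTop (𝓝 0) := by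
      refine tendsto_OmegaInf_of_tendsto_OmegaFin_two f (isSymmetricMeasure_tensorPow f) ?_
      have h2 : (fun N : Set.Ici 2 => OmegaFin N.2 (tensorPow f N) f) = fun _ => 0 :=
        funext fun N => OmegaFin_tensorPow N.2 f
      rw [h2]
      exact tendsto_const_nhds
    have hadd := h.add h0
    rw [add_zero, tendsto_Ici_zero_iff] at hadd
    rw [ENNReal.tendsto_nhds_zero]
    intro ε hε
    obtain ⟨n, hn⟩ := hadd ε hε
    filter_upwards [eventually_ge_atTop (max 1 n)] with N hN
    have hN1 : 1 ≤ N := (le_max_left 1 n).trans hN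
    exact (W1Pow_le_OmegaInf_add hN1 (hG N) f).trans
      (hn ⟨N, hN1⟩ ((le_max_right 1 n).trans hN))
  tfae_have 4 → 2 := by
    intro h j hj
    rw [tendsto_Ici_zero_iff]
    rw [ENNReal.tendsto_nhds_zero] at h
    intro ε hε
    obtain ⟨n, hn⟩ := eventually_atTop.1 (h ε hε)
    refine ⟨n, fun N hN => ?_⟩
    exact (OmegaFin_le_W1Pow (one_le_two.trans hj) N.2 (hG N) f).trans (hn N hN)
  tfae_finish

end Equivalence

/-! ### Polynomial rates under a moment bound. -/

section Quantitative

/-- Markov's inequality, weakened by `‖x‖ ≤ ‖x‖ ^ k` for `‖x‖ ≥ 1`, so that the rate `ε` does not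
depend on `k`. -/
theorem measure_norm_gt_le_of_moment {V : Type*} [NormedAddCommGroup V]
    [MeasurableSpace V] [BorelSpace V] {M k : ℝ} (hk : 1 < k) {f : ProbabilityMeasure V}
    (hf : moment k f ≤ ENNReal.ofReal M) {ε : ℝ} (hε : 0 < ε) (hε1 : ε ≤ 1) :
    (f : Measure V) {x | ε⁻¹ < ‖x‖} ≤ ENNReal.ofReal (M * ε) := by
  have h1 : 1 ≤ ε⁻¹ := (one_le_inv₀ hε).2 hε1
  have hsub : {x : V | ε⁻¹ < ‖x‖} ⊆ {x | ENNReal.ofReal ε⁻¹ ≤ ENNReal.ofReal (‖x‖ ^ k)} := by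
    intro x hx
    have hx : ε⁻¹ < ‖x‖ := hx
    exact ENNReal.ofReal_le_ofReal
      (hx.le.trans (Real.self_le_rpow_of_one_le (h1.trans hx.le) hk.le))
  have hmk := mul_meas_ge_le_lintegral (μ := (f : Measure V))
    (f := fun x => ENNReal.ofReal (‖x‖ ^ k)) (by fun_prop) (ENNReal.ofReal ε⁻¹)
  have h2 : ENNReal.ofReal ε⁻¹ * (f : Measure V) {x | ε⁻¹ < ‖x‖} ≤ ENNReal.ofReal M :=
    (mul_le_mul' le_rfl (measure_mono hsub)).trans (hmk.trans hf)
  calc (f : Measure V) {x | ε⁻¹ < ‖x‖}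
      = ENNReal.ofReal ε * (ENNReal.ofReal ε⁻¹ * (f : Measure V) {x | ε⁻¹ < ‖x‖}) := by
        rw [← mul_assoc, ← ENNReal.ofReal_mul hε.le, mul_inv_cancel₀ hε.ne', ENNReal.ofReal_one,
          one_mul]
    _ ≤ ENNReal.ofReal ε * ENNReal.ofReal M := by gcongr
    _ = ENNReal.ofReal (M * ε) := by rw [← ENNReal.ofReal_mul hε.le, mul_comm]

variable {V : Type*} [NormedAddCommGroup V] [NormedSpace ℝ V] [ProperSpace V]
  [MeasurableSpace V] [BorelSpace V] [SecondCountableTopology V] [StandardBorelSpace V]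

variable (V) in
theorem exists_OmegaInf_le_OmegaFin_two {M k : ℝ} (hM : 1 < M) (hk : 1 < k) :
    ∃ a C : ℝ, 0 < a ∧ a ≤ 1 ∧ 1 ≤ C ∧ ∀ (f : ProbabilityMeasure V) (N : ℕ) (hN : 2 ≤ N)
      (G : ProbabilityMeasure (Fin N → V)), IsSymmetricMeasure G →
      moment k f ≤ ENNReal.ofReal M →
      OmegaInf (one_le_two.trans hN) G f ≤
        ENNReal.ofReal C * (OmegaFin hN G f ^ a + ENNReal.ofReal (1 / (N : ℝ) ^ a)) := by
  obtain ⟨p, D, hD, hnet⟩ := exists_polynomial_net V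
  -- With `m` of order `ε⁻ᵖ`, the factor `m³ / ε²` is of order `ε^(-q)`. The choice `ε ^ (q + 1) =
  -- δ` makes its product with `δ` of order `ε`, like the other two errors.
  set q := 3 * p + 2 with hq
  set a : ℝ := (q + 1 : ℝ)⁻¹ with ha
  have ha0 : 0 < a := by positivity
  have ha1 : a ≤ 1 := inv_le_one_of_one_le₀ (by linarith [(Nat.cast_nonneg q : (0 : ℝ) ≤ q)])
  set K := 4 * (D + 1) ^ 3 with hK
  refine ⟨a, 6 + 2 * M + K, ha0, ha1, by have : 0 < K := by positivity
                                         linarith, fun f N hN G hG hf => ?_⟩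
  have hN0 : (0 : ℝ) < N := by exact_mod_cast (by omega : 0 < N)
  set δ := (N : ℝ≥0∞)⁻¹ + OmegaFin hN G f with hδ
  have hNa : (N : ℝ≥0∞)⁻¹ ^ a = ENNReal.ofReal (1 / (N : ℝ) ^ a) := by
    rw [one_div, ← Real.inv_rpow hN0.le, ← ENNReal.ofReal_rpow_of_pos (by positivity),
      ENNReal.ofReal_inv_of_pos hN0, ENNReal.ofReal_natCast]
  have hδa : δ ^ a ≤ OmegaFin hN G f ^ a + ENNReal.ofReal (1 / (N : ℝ) ^ a) := by
    rw [← hNa, add_comm]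
    exact ENNReal.rpow_add_le_add_rpow _ _ ha0.le ha1
  refine le_trans ?_ (mul_le_mul' le_rfl hδa)
  have hC1 : 1 ≤ ENNReal.ofReal (6 + 2 * M + K) := by
    rw [← ENNReal.ofReal_one]
    refine ENNReal.ofReal_le_ofReal ?_
    have : 0 < K := by positivity
    linarith
  -- If `δ ≥ 1` the trivial bound `Ω_∞ ≤ 1` is enough.
  rcases le_total 1 δ with h1 | h1
  · calc OmegaInf (one_le_two.trans hN) G f ≤ 1 * 1 := by
          rw [one_mul]; exact OmegaInf_le_one _ _ _
      _ ≤ _ := mul_le_mul' hC1 (ENNReal.one_le_rpow h1 ha0)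
  have hδt : δ ≠ ∞ := ne_top_of_le_ne_top ENNReal.one_ne_top h1
  set t := δ.toReal with ht
  have ht0 : 0 < t := ENNReal.toReal_pos (by
    intro h
    have := (add_eq_zero.1 h).1
    simp at this) hδt
  have ht1 : t ≤ 1 := by
    have := ENNReal.toReal_mono ENNReal.one_ne_top h1
    simpa using this
  have hδe : δ = ENNReal.ofReal t := (ENNReal.ofReal_toReal hδt).symm
  set ε := t ^ a with hε
  have hε0 : 0 < ε := by positivity
  have hε1 : ε ≤ 1 := Real.rpow_le_one ht0.le ht1 ha0.le
  have hεt : ε ^ (q + 1) = t := by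
    rw [hε, ← Real.rpow_natCast, ← Real.rpow_mul ht0.le, ha]
    push_cast
    rw [inv_mul_cancel₀ (by positivity), Real.rpow_one]
  obtain ⟨m, z, hz, hm⟩ := hnet ε hε0 hε1
  have hcov := OmegaInf_le_of_covering hN hG f z hε0 hε1
  have htail : (f : Measure V) {x | ∀ i, ε < dist x (z i)} ≤ ENNReal.ofReal (M * ε) := by
    refine (measure_mono fun x hx => ?_).trans (measure_norm_gt_le_of_moment hk hf hε0 hε1)
    by_contra h
    obtain ⟨i, hi⟩ := hz x (not_lt.1 h)
    exact absurd (hx i) (not_lt.2 hi)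
  have hcoef : 4 * (m + 1 : ℝ) ^ 3 / ε ^ 2 * t ≤ K * ε := by
    have h1ε : 1 ≤ (ε⁻¹) ^ p := one_le_pow₀ ((one_le_inv₀ hε0).2 hε1)
    have hm1 : (m + 1 : ℝ) ≤ (D + 1) * (ε⁻¹) ^ p := by linarith
    calc 4 * (m + 1 : ℝ) ^ 3 / ε ^ 2 * t
        ≤ 4 * ((D + 1) * (ε⁻¹) ^ p) ^ 3 / ε ^ 2 * t := by gcongr
      _ = K * ε := by
          rw [← hεt, hK, hq, inv_pow]
          field_simp
          ring
  rw [hδe, ENNReal.ofReal_rpow_of_pos ht0, ← ENNReal.ofReal_mul (by positivity)]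
  calc OmegaInf (one_le_two.trans hN) G f ≤ _ := hcov
    _ ≤ ENNReal.ofReal (6 * ε) + 2 * ENNReal.ofReal (M * ε) +
        ENNReal.ofReal (4 * (m + 1) ^ 3 / ε ^ 2) * ENNReal.ofReal t := by
        rw [← hδe]; gcongr
    _ = ENNReal.ofReal (6 * ε + 2 * (M * ε) + 4 * (m + 1) ^ 3 / ε ^ 2 * t) := by
        have : 0 < M * ε := by positivity
        rw [← ENNReal.ofReal_mul (by positivity), ← ENNReal.ofReal_ofNat 2,
          ← ENNReal.ofReal_mul zero_le_two, ← ENNReal.ofReal_add (by positivity) (by positivity),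
          ← ENNReal.ofReal_add (by positivity) (by positivity)]
    _ ≤ ENNReal.ofReal ((6 + 2 * M + K) * ε) := by
        refine ENNReal.ofReal_le_ofReal ?_
        linarith

variable (V) in
-- Every comparison passes through `Ω_∞`: from `l` down to `Ω₂` and then to `Ω_∞(G)`, and from there
-- to `Ω_j ≤ Ω_N ≤ Ω_∞(G) + Ω_∞(f^{⊗N})`. The two summands account for the factor `2` in the
-- constant.
theorem exists_Omega_le_Omega {M k : ℝ} (hM : 1 < M) (hk : 1 < k) :
    ∃ a C : ℝ, 0 < a ∧ 0 < C ∧ ∀ (f : ProbabilityMeasure V) (N : ℕ) (hN : 1 ≤ N)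
      (G : ProbabilityMeasure (Fin N → V)), IsSymmetricMeasure G →
      moment k f ≤ ENNReal.ofReal M → ∀ j l : WithTop (Set.Icc 2 N),
      Omega hN G f j ≤
        ENNReal.ofReal C * (Omega hN G f l ^ a + ENNReal.ofReal (1 / (N : ℝ) ^ a)) := by
  obtain ⟨a, C, ha0, ha1, hC, h⟩ := exists_OmegaInf_le_OmegaFin_two V hM hk
  refine ⟨a, 2 * C, ha0, by positivity, fun f N hN G hG hf j l => ?_⟩
  have hC1 : 1 ≤ ENNReal.ofReal C := by
    rw [← ENNReal.ofReal_one]; exact ENNReal.ofReal_le_ofReal hC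
  have hinf : OmegaInf hN G f ≤
      ENNReal.ofReal C * (Omega hN G f l ^ a + ENNReal.ofReal (1 / (N : ℝ) ^ a)) := by
    cases l with
    | top =>
      refine le_trans ?_ (le_mul_of_one_le_left' hC1)
      refine le_trans ?_ le_self_add
      -- As `Ω_∞ ≤ 1` and `a ≤ 1`, raising to the power `a` only increases it.
      have := ENNReal.rpow_le_rpow_of_exponent_ge (OmegaInf_le_one hN G f) ha1
      rwa [ENNReal.rpow_one] at this
    | coe l =>
      have hN2 : 2 ≤ N := l.2.1.trans l.2.2
      refine (h f N hN2 G hG hf).trans ?_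
      gcongr
      exact OmegaFin_mono one_le_two l.2.1 l.2.2 hG f
  have h2C : ENNReal.ofReal (2 * C) = ENNReal.ofReal C + ENNReal.ofReal C := by
    rw [two_mul, ENNReal.ofReal_add (by positivity) (by positivity)]
  rw [h2C, add_mul]
  cases j with
  | top => exact hinf.trans le_self_add
  | coe j =>
    have hN2 : 2 ≤ N := j.2.1.trans j.2.2
    refine (OmegaFin_le_W1Pow (one_le_two.trans j.2.1) j.2.2 hG f).trans ?_
    refine (W1Pow_le_OmegaInf_add hN hG f).trans (add_le_add hinf ?_)
    -- For the tensor power itself `Ω₂` vanishes, and only the term in `1 / N ^ a` survives.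
    refine (h f N hN2 _ (isSymmetricMeasure_tensorPow f N) hf).trans ?_
    rw [OmegaFin_tensorPow, ENNReal.zero_rpow_of_pos ha0, zero_add]
    gcongr
    exact le_add_self

end Quantitative

end

theorem mainTheorem5 (d : ℕ) :
    -- the two expressions of `Ω_∞` agree
    (∀ (f : ProbabilityMeasure (EuclideanSpace ℝ (Fin d))) (N : ℕ) (hN : 1 ≤ N)
        (G : ProbabilityMeasure (Fin N → EuclideanSpace ℝ (Fin d))), IsSymmetricMeasure G →
      OmegaInf hN G f =
        ∫⁻ z, W1 (empiricalMeasure hN z) f ∂(G : Measure (Fin N → EuclideanSpace ℝ (Fin d)))) ∧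
    -- the convergences are equivalent
    (∀ (f : ProbabilityMeasure (EuclideanSpace ℝ (Fin d)))
        (G : ∀ N : ℕ, ProbabilityMeasure (Fin N → EuclideanSpace ℝ (Fin d))),
        (∀ N, IsSymmetricMeasure (G N)) →
      List.TFAE [
        ∃ j : ℕ, 2 ≤ j ∧
          Tendsto (fun N : Set.Ici j => OmegaFin N.2 (G N) f) atTop (𝓝 0),
        ∀ j : ℕ, 2 ≤ j →
          Tendsto (fun N : Set.Ici j => OmegaFin N.2 (G N) f) atTop (𝓝 0),
        Tendsto (fun N : Set.Ici 1 => OmegaInf N.2 (G N) f) atTop (𝓝 0),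
        Tendsto (fun N : ℕ => W1Pow (G N) (tensorPow f N)) atTop (𝓝 0)]) ∧
    -- the quantitative comparison
    (∀ M k : ℝ, 1 < M → 1 < k →
      ∃ α₁ α₂ C : ℝ, 0 < α₁ ∧ 0 < α₂ ∧ 0 < C ∧
        ∀ (f : ProbabilityMeasure (EuclideanSpace ℝ (Fin d))) (N : ℕ) (hN : 1 ≤ N)
          (G : ProbabilityMeasure (Fin N → EuclideanSpace ℝ (Fin d))),
          IsSymmetricMeasure G →
          moment k (firstMarginal hN G) ≤ ENNReal.ofReal M →
          moment k f ≤ ENNReal.ofReal M →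
          ∀ j l : WithTop (Set.Icc 2 N),
            Omega hN G f j ≤
              ENNReal.ofReal C * (Omega hN G f l ^ α₁ + ENNReal.ofReal (1 / (N : ℝ) ^ α₂))) := by
  refine ⟨fun f N hN G _ => OmegaInf_eq_lintegral hN G f,
    fun f G hG => tfae_tendsto_Omega f G hG, fun M k hM hk => ?_⟩
  obtain ⟨a, C, ha, hC, h⟩ := exists_Omega_le_Omega (EuclideanSpace ℝ (Fin d)) hM hk
  exact ⟨a, a, C, ha, ha, hC, fun f N hN G hG _ hf j l => h f N hN G hG hf j l⟩
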